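/- **Setting.** Let $E$ be a separable real Hilbert space and let $\mathcal D_{\rm source},\mathcal D_{\rm target}$ be distributions of $(\mathbf x,y)\in E\times\mathbb R$ with $\mathbb E\|\mathbf x\|^2<\infty$ and $\mathbb E y^2<\infty$. Put $\mathbf G=\mathbb E_{\rm source}[\mathbf x\mathbf x^\top]$ and $\mathbf H=\mathbb E_{\rm target}[\mathbf x\mathbf x^\top]$, both assumed strictly positive definite. Let $(\mu_j)$, $(\mathbf v_j)$ be the eigenvalues and an orthonormal eigenbasis of $\mathbf G$. For a set $J$ of indices write $\mathbf G_J=\sum_{j\in J}\mu_j\mathbf v_j\mathbf v_j^\top$, $\mathbf G_J^{-1}=\sum_{j\in J}\mu_j^{-1}\mathbf v_j\mathbf v_j^\top$, $\mathbf I_J=\sum_{j\in J}\mathbf v_j\mathbf v_j^\top$, and let $J^c$ be the complement of $J$. Write $\|\mathbf u\|_{\mathbf A}^2=\mathbf u^\top\mathbf A\mathbf u$. Let $R_{\rm source}(\mathbf w)=\tfrac12\mathbb E_{\rm source}(y-\langle\mathbf w,\mathbf x\rangle)^2$ and $R_{\rm target}(\mathbf w)=\tfrac12\mathbb E_{\rm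 target}(y-\langle\mathbf w,\mathbf x\rangle)^2$. Assume that $\mathbf w^*$ minimizes both risks, and let $\mathcal E(\mathbf w)=R_{\rm target}(\mathbf w)-R_{\rm target}(\mathbf w^*)$ be the target excess risk. **Algorithm.** Let $M>100$, $M_{\rm eff}=M/\log_2 M$, $\gamma>0$, and $\gamma_t=\gamma/2^{\lfloor t/M_{\rm eff}\rfloor}$ for $0\le t<M$. From an arbitrary $\mathbf w_0\in E$ run $$\mathbf w_t=\mathbf w_{t-1}-\gamma_{t-1}(\mathbf x_t\mathbf x_t^\top\mathbf w_{t-1}-\mathbf x_ty_t),\qquad t=1,\dots,M,$$ on independent samples $(\mathbf x_t,y_t)\sim\mathcal D_{\rm source}$ (no target data). **Assumptions.** For both distributions, with $\boldsymbol\Sigma=\mathbb E[\mathbf x\mathbf x^\top]$ (so $\boldsymbol\Sigma=\mathbf G$ for the source and $\boldsymbol\Sigma=\mathbf H$ for the target), $\mathbb E\|\mathbf x\|^4<\infty$, and with the same $\alpha>0$, $\sigma>0$: $\mathbb E[\mathbf x\mathbf x^\top\mathbf A\mathbf x\mathbf x^\top]\preceq\alpha\,\mathrm{tr}(\boldsymbol\Sigma\mathbf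 A)\,\boldsymbol\Sigma$ for every bounded positive semidefinite $\mathbf A$; and $\mathbb E[(y-\langle\mathbf w^*,\mathbf x\rangle)^2\mathbf x\mathbf x^\top]\preceq\sigma^2\boldsymbol\Sigma$ (with $\mathbb E[(y-\langle\mathbf w^*,\mathbf x\rangle)^2\|\mathbf x\|^2]<\infty$). Moreover $\gamma<1/(4\alpha\,\mathrm{tr}(\mathbf G))$. **Claim.** There are absolute constants $C,c>0$ such that the following holds. Put, for an index set $J$, $$D_{\rm eff}^{\rm pretrain}=\mathrm{tr}(\mathbf H\mathbf G_J^{-1})+M_{\rm eff}^2\gamma^2\,\mathrm{tr}(\mathbf H\mathbf G_{J^c})\in[0,\infty].$$ (1) For every index set $J$, $$\mathbb E\,\mathcal E(\mathbf w_M)\le C\Big[\Big\|\prod_{t=0}^{M-1}(\mathbf I-\gamma_t\mathbf G)(\mathbf w_0-\mathbf w^*)\Big\|_{\mathbf H}^2+\Big(\alpha\|\mathbf w_0-\mathbf w^*\|^2_{\frac{\mathbf I_J}{M_{\rm eff}\gamma}+\mathbf G_{J^c}}+\sigma^2\Big)\frac{D_{\rm eff}^{\rm pretrain}}{M_{\rm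 eff}}\Big].$$ (2) Suppose in addition that, for both distributions and some common $\beta>0$, $\mathbb E[\mathbf x\mathbf x^\top\mathbf A\mathbf x\mathbf x^\top]-\boldsymbol\Sigma\mathbf A\boldsymbol\Sigma\succeq\beta\,\mathrm{tr}(\boldsymbol\Sigma\mathbf A)\,\boldsymbol\Sigma$ for every bounded positive semidefinite $\mathbf A$, and that $y=\langle\mathbf w^*,\mathbf x\rangle+\epsilon$ with $\epsilon\sim\mathcal N(0,\sigma^2)$ independent of $\mathbf x$. Then for $J=\{j:\mu_j\ge 1/(\gamma M_{\rm eff})\}$, $$\mathbb E\,\mathcal E(\mathbf w_M)\ge c\Big[\Big\|\prod_{t=0}^{M-1}(\mathbf I-\gamma_t\mathbf G)(\mathbf w_0-\mathbf w^*)\Big\|_{\mathbf H}^2+\big(\beta\|\mathbf w_0-\mathbf w^*\|^2_{\mathbf G_{J^c}}+\sigma^2\big)\frac{D_{\rm eff}^{\rm pretrain}}{M_{\rm eff}}\Big].$$ -/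

import Mathlib

open MeasureTheory ProbabilityTheory
open scoped ENNReal NNReal RealInnerProductSpace

noncomputable section

namespace CovShift

/-! A data distribution is a probability measure on `E × ℝ`: a covariate `p.1` in a separable real
Hilbert space `E` together with a response `p.2`. -/

section Moments

variable {E : Type*} [NormedAddCommGroup E] [InnerProductSpace ℝ E] [MeasurableSpace E]

/-- The operator `x xᵀ`, that is `v ↦ ⟪x, v⟫ x`. -/
def outer (x : E) : E →L[ℝ] E := InnerProductSpace.rankOne ℝ x x

/-- The covariance operator `𝔼[x xᵀ]` of the covariate. -/
def secondMoment (D : Measure (E × ℝ)) : E →L[ℝ] E := ∫ p, outer p.1 ∂D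

/-- The operator `𝔼[x xᵀ A x xᵀ]`. -/
def fourthMoment (D : Measure (E × ℝ)) (A : E →L[ℝ] E) : E →L[ℝ] E :=
  ∫ p, outer p.1 ∘L A ∘L outer p.1 ∂D

/-- The risk `𝔼 (y - ⟪w, x⟫)² / 2` of a parameter `w`. -/
def risk (D : Measure (E × ℝ)) (w : E) : ℝ := (1 / 2) * ∫ p, (p.2 - ⟪w, p.1⟫) ^ 2 ∂D

/-- The excess risk of `w` relative to the minimizer `wStar`. -/
def excessRisk (D : Measure (E × ℝ)) (wStar w : E) : ℝ := risk D w - risk D wStar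

/-- The covariance has finite trace (`𝔼‖x‖² < ∞`), and the risks are finite (`𝔼 y² < ∞`). -/
structure FiniteSecondMoments (D : Measure (E × ℝ)) : Prop where
  covariate : Integrable (fun p : E × ℝ => ‖p.1‖ ^ 2) D
  response : Integrable (fun p : E × ℝ => p.2 ^ 2) D

/-- Strict positive definiteness of an operator. -/
def StrictlyPositive (T : E →L[ℝ] E) : Prop := ∀ v : E, v ≠ 0 → 0 < ⟪v, T v⟫

/-- A covariate shift problem for linear regression: source and target distributions with finite
second moments and positive definite covariances, and a parameter `wStar` that minimizes both
risks. -/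
structure IsCovariateShift (DS DT : Measure (E × ℝ)) (wStar : E) : Prop where
  source_moments : FiniteSecondMoments DS
  target_moments : FiniteSecondMoments DT
  source_pos : StrictlyPositive (secondMoment DS)
  target_pos : StrictlyPositive (secondMoment DT)
  source_min : ∀ w, risk DS wStar ≤ risk DS w
  target_min : ∀ w, risk DT wStar ≤ risk DT w

/-- Noise condition:
`𝔼[(y - ⟪wStar, x⟫)² x xᵀ] ≼ σ² 𝔼[x xᵀ]`, the left side being well defined. -/
structure NoiseBound (D : Measure (E × ℝ)) (wStar : E) (σ : ℝ) : Prop where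
  integrable : Integrable (fun p : E × ℝ => (p.2 - ⟪wStar, p.1⟫) ^ 2 * ‖p.1‖ ^ 2) D
  bound : ∫ p, (p.2 - ⟪wStar, p.1⟫) ^ 2 • outer p.1 ∂D ≤ σ ^ 2 • secondMoment D

/-- Well-specified noise: `y = ⟪wStar, x⟫ + ε` with `ε ∼ 𝒩(0, σ²)` independent of `x`. -/
structure WellSpecified (D : Measure (E × ℝ)) (wStar : E) (σ : ℝ) : Prop where
  gaussian : HasLaw (fun p : E × ℝ => p.2 - ⟪wStar, p.1⟫) (gaussianReal 0 (σ ^ 2).toNNReal) D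
  indep : IndepFun (fun p : E × ℝ => p.1) (fun p : E × ℝ => p.2 - ⟪wStar, p.1⟫) D

end Moments

section Trace

variable {E : Type*} [NormedAddCommGroup E] [InnerProductSpace ℝ E] [CompleteSpace E]

/-- The trace of a (trace class) operator, computed in some orthonormal Hilbert basis. -/
def trace (T : E →L[ℝ] E) : ℝ :=
  ∑' i : (exists_hilbertBasis ℝ E).choose,
    ⟪(exists_hilbertBasis ℝ E).choose_spec.choose i,
      T ((exists_hilbertBasis ℝ E).choose_spec.choose i)⟫

variable [MeasurableSpace E]

/-- Upper fourth moment condition: `𝔼[x xᵀ A x xᵀ] ≼ α tr(G A) G` for every PSD `A`, where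
`G = 𝔼[x xᵀ]`. -/
structure FourthMomentUpper (D : Measure (E × ℝ)) (α : ℝ) : Prop where
  integrable : Integrable (fun p : E × ℝ => ‖p.1‖ ^ 4) D
  bound : ∀ A : E →L[ℝ] E, A.IsPositive →
    fourthMoment D A ≤ (α * trace (secondMoment D ∘L A)) • secondMoment D

/-- Lower fourth moment condition: `β tr(G A) G ≼ 𝔼[x xᵀ A x xᵀ] - G A G` for every PSD `A`,
where `G = 𝔼[x xᵀ]`. -/
structure FourthMomentLower (D : Measure (E × ℝ)) (β : ℝ) : Prop where
  integrable : Integrable (fun p : E × ℝ => ‖p.1‖ ^ 4) D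
  bound : ∀ A : E →L[ℝ] E, A.IsPositive →
    (β * trace (secondMoment D ∘L A)) • secondMoment D ≤
      fourthMoment D A - secondMoment D ∘L A ∘L secondMoment D

end Trace

section Algorithm

variable {E : Type*} [NormedAddCommGroup E] [InnerProductSpace ℝ E]

/-- The effective number of samples `M / log₂ M`. -/
def effSamples (M : ℕ) : ℝ := M / Real.logb 2 M

/-- The geometrically decaying stepsizes: `γ` is halved after every `M / log₂ M` steps. -/
def stepsize (M : ℕ) (γ : ℝ) (t : ℕ) : ℝ := γ / 2 ^ ⌊(t : ℝ) / effSamples M⌋₊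

/-- The SGD iterates `w_{t+1} = w_t - γ_t (x xᵀ w_t - x y)`, where `(x, y) = z t` is the sample
used in the step from `w_t` to `w_{t+1}`. -/
def sgd (η : ℕ → ℝ) (w₀ : E) (z : ℕ → E × ℝ) : ℕ → E
  | 0 => w₀
  | t + 1 => sgd η w₀ z t - η t • (outer (z t).1 (sgd η w₀ z t) - (z t).2 • (z t).1)

/-- The operator `∏_{t < M} (I - γ_t G)`. -/
def contraction (η : ℕ → ℝ) (G : E →L[ℝ] E) (M : ℕ) : E →L[ℝ] E :=
  ((List.range M).map fun t => ContinuousLinearMap.id ℝ E - η t • G).prod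

/-- `‖u‖²_S = uᵀ S u`. -/
def sqNorm (S : E →L[ℝ] E) (u : E) : ℝ := ⟪u, S u⟫

end Algorithm

section Spectral

/-! The (possibly unbounded) operators `∑ⱼ φ j • v j (v j)ᵀ` with weights `φ j ≥ 0` along an
orthonormal basis `v` enter through two quantities with values in `[0, ∞]`. -/

variable {E : Type*} [NormedAddCommGroup E] [InnerProductSpace ℝ E] {ι : Type*}

/-- `‖u‖²_S = uᵀ S u` for `S = ∑ⱼ φ j • v j (v j)ᵀ`. -/
def weightedSq (v : HilbertBasis ι ℝ E) (φ : ι → ℝ) (u : E) : ℝ≥0∞ :=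
  ∑' j, ENNReal.ofReal (φ j * ⟪v j, u⟫ ^ 2)

/-- `tr(H S) = ∑ⱼ φ j (v j)ᵀ H (v j)` for `S = ∑ⱼ φ j • v j (v j)ᵀ` and a PSD operator `H`. -/
def weightedTrace (v : HilbertBasis ι ℝ E) (φ : ι → ℝ) (H : E →L[ℝ] E) : ℝ≥0∞ :=
  ∑' j, ENNReal.ofReal (φ j * ⟪v j, H (v j)⟫)

/-- Spectral weights of `G_J⁻¹`, where `μ` lists the eigenvalues of `G`. -/
def headInv (μ : ι → ℝ) (J : Set ι) : ι → ℝ := J.indicator fun j => (μ j)⁻¹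

/-- Spectral weights of `G_{Jᶜ}`, where `μ` lists the eigenvalues of `G`. -/
def tail (μ : ι → ℝ) (J : Set ι) : ι → ℝ := Jᶜ.indicator μ

/-- Spectral weights of `a I_J + G_{Jᶜ}`, where `μ` lists the eigenvalues of `G`. -/
def headConstTail (a : ℝ) (μ : ι → ℝ) (J : Set ι) : ι → ℝ :=
  fun j => J.indicator (fun _ => a) j + tail μ J j

/-- The effective dimension `tr(H G_J⁻¹) + m² γ² tr(H G_{Jᶜ})` of pretraining with effective
sample number `m`. -/
def effDim (v : HilbertBasis ι ℝ E) (μ : ι → ℝ) (J : Set ι) (H : E →L[ℝ] E) (m γ : ℝ) : ℝ≥0∞ :=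
  weightedTrace v (headInv μ J) H +
    ENNReal.ofReal (m ^ 2 * γ ^ 2) * weightedTrace v (tail μ J) H

end Spectral

end CovShift

end

/-! Write `G`, `H` for the source and target second moments and `m = effSamples M`. Since `wStar`
minimizes the target risk, the excess risk is half of `⟪e, H e⟫` with `e = w - wStar`, so the object
to follow is `energy`, the mean of `⟪e, A e⟫`, at `A = H`. One SGD step conjugates `A` by `I - η_t
G` and adds `η_t² tr(G A)` times a noise level, controlled by `energy` at `G` and by `σ²`: see
`integral_inner_devStep_le` and `le_integral_inner_devStep`. Unrolled (`energy_toReal_le`,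
`le_energy_toReal`), this gives the deterministic bias plus a sum of `η_t² q_t tr(G P_t H P_t)`,
where `P_t` is the product of the later contractions and, up to a factor 2, `q_t` is the noise
level. As `G` and `P_t` are diagonal in `v`, only the entries `⟪v j, H (v j)⟫` enter, so `G` and `H`
need not commute. What remains is one scalar sum per eigenvalue `μ`, to be compared with `1/(m μ)`
on `J` and with `m γ² μ` off `J`.

Upper bound: `q` depends on the unknown energies, but at `A = G` the recursion closes into a
discrete Volterra inequality whose kernel is small because `4 α γ tr G ≤ 1`. `volterra_bounds`
controls `q` in the mean and, after weighting by the elapsed stepsizes, pointwise. Early values of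
`q` may be large, but their effect is contracted by all later steps; `weightedSum_le_head` combines
the mean bound for `t < m`, the pointwise bound afterwards, and `stepsize_mul_decay_le`. Off `J`
contraction is ignored. Neither estimate relates `μ` to `J`, so `J` is arbitrary.

Lower bound: directions with `μ < 1/(γ m)` are hardly contracted, which keeps `q` above a multiple
of its target value. A direction with larger `μ` collects enough noise during the single phase in
which `η_t μ m` lies between 1 and 2 (`le_weightedSum_head`). -/

noncomputable section

namespace CovShift

set_option linter.unusedSectionVars false

/-! ### Contraction factors along one eigendirection. -/

section Decay

/-- The factor `∏_{s ≤ k < t} (1 - η_k μ)` by which an eigendirection with eigenvalue `μ` is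
contracted between times `s` and `t`. -/
def decay (η : ℕ → ℝ) (μ : ℝ) (s t : ℕ) : ℝ := ∏ k ∈ Finset.Ico s t, (1 - η k * μ)

variable {η : ℕ → ℝ} {μ : ℝ}

lemma decay_self (η : ℕ → ℝ) (μ : ℝ) (s : ℕ) : decay η μ s s = 1 := by simp [decay]

lemma decay_succ (η : ℕ → ℝ) (μ : ℝ) {s t : ℕ} (h : s ≤ t) :
    decay η μ s (t + 1) = decay η μ s t * (1 - η t * μ) := Finset.prod_Ico_succ_top h _

lemma decay_nonneg (h : ∀ k, η k * μ ≤ 1 / 4) (s t : ℕ) : 0 ≤ decay η μ s t :=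
  Finset.prod_nonneg fun k _ => by linarith [h k]

lemma decay_le_one (h0 : ∀ k, 0 ≤ η k * μ) (h : ∀ k, η k * μ ≤ 1 / 4) (s t : ℕ) :
    decay η μ s t ≤ 1 :=
  Finset.prod_le_one (fun k _ => by linarith [h k]) fun k _ => by linarith [h0 k]

lemma decay_sq_le (h0 : ∀ k, 0 ≤ η k * μ) (h : ∀ k, η k * μ ≤ 1 / 4) (s t : ℕ) :
    decay η μ s t ^ 2 ≤ decay η μ s t := by
  nlinarith [decay_nonneg h s t, decay_le_one h0 h s t]

lemma decay_sq_le_one (h0 : ∀ k, 0 ≤ η k * μ) (h : ∀ k, η k * μ ≤ 1 / 4) (s t : ℕ) :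
    decay η μ s t ^ 2 ≤ 1 :=
  (decay_sq_le h0 h s t).trans (decay_le_one h0 h s t)

lemma decay_le_decay (h0 : ∀ k, 0 ≤ η k * μ) (h : ∀ k, η k * μ ≤ 1 / 4) {t t' : ℕ} (s : ℕ)
    (htt : t ≤ t') : decay η μ s t' ≤ decay η μ s t :=
  Finset.prod_le_prod_of_subset_of_le_one (Finset.Ico_subset_Ico le_rfl htt)
    (fun k _ => by linarith [h k]) fun k _ _ => by linarith [h0 k]

/-- Telescoping in the left endpoint: each summand is `decay η μ (t + 1) n - decay η μ t n`. -/
lemma sum_mul_decay_eq (η : ℕ → ℝ) (μ : ℝ) (n : ℕ) :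
    ∑ t ∈ Finset.range n, η t * μ * decay η μ (t + 1) n = 1 - decay η μ 0 n := by
  induction n with
  | zero => simp [decay]
  | succ n ih =>
    have : ∑ t ∈ Finset.range n, η t * μ * decay η μ (t + 1) (n + 1) =
        (∑ t ∈ Finset.range n, η t * μ * decay η μ (t + 1) n) * (1 - η n * μ) := by
      rw [Finset.sum_mul]
      refine Finset.sum_congr rfl fun t ht => ?_
      rw [decay_succ _ _ (by simpa using ht)]; ring
    rw [Finset.sum_range_succ, this, ih, decay_self, decay_succ _ _ (Nat.zero_le n)]; ring

lemma sum_mul_decay_sq_le (h0 : ∀ k, 0 ≤ η k * μ) (h : ∀ k, η k * μ ≤ 1 / 4) (n : ℕ) :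
    ∑ t ∈ Finset.range n, η t * μ * decay η μ (t + 1) n ^ 2 ≤ 1 :=
  calc _ ≤ ∑ t ∈ Finset.range n, η t * μ * decay η μ (t + 1) n :=
        Finset.sum_le_sum fun t _ => mul_le_mul_of_nonneg_left (decay_sq_le h0 h _ _) (h0 t)
    _ ≤ 1 := by rw [sum_mul_decay_eq]; linarith [decay_nonneg h 0 n]

/-- Telescoping in the right endpoint. -/
lemma sum_Ico_mul_decay_eq (η : ℕ → ℝ) (μ : ℝ) {s n : ℕ} (hs : s ≤ n) :
    ∑ t ∈ Finset.Ico s n, η t * μ * decay η μ s t = 1 - decay η μ s n := by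
  induction n, hs using Nat.le_induction with
  | base => simp [decay]
  | succ n hn ih => rw [Finset.sum_Ico_succ_top hn, ih, decay_succ _ _ hn]; ring

lemma sum_Ico_mul_decay_sq_le (h0 : ∀ k, 0 ≤ η k * μ) (h : ∀ k, η k * μ ≤ 1 / 4) {s n : ℕ}
    (hs : s ≤ n) : ∑ t ∈ Finset.Ico s n, η t * μ * decay η μ s t ^ 2 ≤ 1 :=
  calc _ ≤ ∑ t ∈ Finset.Ico s n, η t * μ * decay η μ s t :=
        Finset.sum_le_sum fun t _ => mul_le_mul_of_nonneg_left (decay_sq_le h0 h _ _) (h0 t)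
    _ ≤ 1 := by rw [sum_Ico_mul_decay_eq _ _ hs]; linarith [decay_nonneg h s n]

lemma decay_le_exp (h : ∀ k, η k * μ ≤ 1 / 4) (s t : ℕ) :
    decay η μ s t ≤ Real.exp (-((∑ k ∈ Finset.Ico s t, η k) * μ)) := by
  rw [Finset.sum_mul, ← Finset.sum_neg_distrib, Real.exp_sum]
  exact Finset.prod_le_prod (fun k _ => by linarith [h k]) fun k _ => by
    linarith [Real.add_one_le_exp (-(η k * μ))]

/-- Factor by factor: `(1 - x)(1 + 2x) ≥ 1` on `[0, 1/4]`, hence `1 - x ≥ exp (-2x)`. -/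
lemma exp_le_decay (h0 : ∀ k, 0 ≤ η k * μ) (h : ∀ k, η k * μ ≤ 1 / 4) (s t : ℕ) :
    Real.exp (-2 * ((∑ k ∈ Finset.Ico s t, η k) * μ)) ≤ decay η μ s t := by
  rw [Finset.sum_mul, Finset.mul_sum, Real.exp_sum]
  refine Finset.prod_le_prod (fun k _ => (Real.exp_pos _).le) fun k _ => ?_
  have h1 := h0 k
  have h2 := h k
  have h3 : -2 * (η k * μ) = -(2 * (η k * μ)) := by ring
  rw [h3, Real.exp_neg, inv_le_iff_one_le_mul₀ (Real.exp_pos _)]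
  nlinarith [Real.add_one_le_exp (2 * (η k * μ))]

/-- Step `s` is counted in the sum but does not contract; its share is at most 1/4, and `(1 + 2R)
exp (-2R) ≤ 1` handles the rest. This supplies the pointwise kernel bound in `volterra_bounds`. -/
lemma sum_Ico_mul_decay_sq_succ_le (h0 : ∀ k, 0 ≤ η k * μ) (h : ∀ k, η k * μ ≤ 1 / 4) {s t : ℕ}
    (hst : s < t) :
    (∑ k ∈ Finset.Ico s t, η k) * μ * decay η μ (s + 1) t ^ 2 ≤ 1 / 2 := by
  set R := (∑ k ∈ Finset.Ico (s + 1) t, η k) * μ with hR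
  have hR0 : 0 ≤ R := by
    rw [hR, Finset.sum_mul]; exact Finset.sum_nonneg fun k _ => h0 k
  have h1 : decay η μ (s + 1) t ^ 2 ≤ Real.exp (-(2 * R)) := by
    have := pow_le_pow_left₀ (decay_nonneg h _ _) (decay_le_exp h (s + 1) t) 2
    rwa [← Real.exp_nat_mul, ← hR, show ((2 : ℕ) : ℝ) * -R = -(2 * R) by push_cast; ring] at this
  have h2 : (1 + 2 * R) * Real.exp (-(2 * R)) ≤ 1 := by
    rw [Real.exp_neg, ← div_eq_mul_inv, div_le_one (Real.exp_pos _)]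
    linarith [Real.add_one_le_exp (2 * R)]
  have h3 : (∑ k ∈ Finset.Ico s t, η k) * μ = η s * μ + R := by
    rw [Finset.sum_eq_sum_Ico_succ_bot hst, add_mul]
  rw [h3]
  have h4 : η s * μ + R ≤ (1 + 2 * R) / 2 := by linarith [h s]
  calc _ ≤ (1 + 2 * R) / 2 * Real.exp (-(2 * R)) := by
        refine mul_le_mul h4 h1 (sq_nonneg _) (by positivity)
    _ ≤ 1 / 2 := by linarith

end Decay

/-! ### The geometric stepsize schedule. -/

section Stepsize

variable {M : ℕ} {γ : ℝ}

lemma logb_pos (hM : 100 < M) : 1 ≤ Real.logb 2 M := by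
  have : (100 : ℝ) < M := by exact_mod_cast hM
  rw [Real.le_logb_iff_rpow_le (by norm_num) (by linarith)]; norm_num; linarith

lemma effSamples_le (hM : 100 < M) : effSamples M ≤ M :=
  div_le_self (Nat.cast_nonneg _) (logb_pos hM)

lemma two_le_effSamples (hM : 100 < M) : 2 ≤ effSamples M := by
  have hM' : (100 : ℝ) < M := by exact_mod_cast hM
  have h1 := logb_pos hM
  rw [effSamples, le_div_iff₀ (by linarith), Real.logb, mul_div_assoc',
    div_le_iff₀ (Real.log_pos (by norm_num))]
  have h2 : Real.log M = Real.log 64 + Real.log (M / 64) := by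
    rw [← Real.log_mul (by norm_num) (by positivity)]; congr 1; ring
  have h3 : Real.log 64 = 6 * Real.log 2 := by
    rw [show (64 : ℝ) = 2 ^ 6 by norm_num, Real.log_pow]; norm_num
  have h4 := Real.log_le_sub_one_of_pos (show (0 : ℝ) < M / 64 by positivity)
  nlinarith [Real.log_two_gt_d9]

lemma stepsize_pos (hγ : 0 < γ) (t : ℕ) : 0 < stepsize M γ t := by
  unfold stepsize; positivity

lemma stepsize_antitone (hM : 100 < M) (hγ : 0 < γ) : Antitone (stepsize M γ) := by
  intro s t hst
  have := two_le_effSamples hM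
  unfold stepsize
  gcongr
  norm_num

lemma stepsize_le (hγ : 0 < γ) (t : ℕ) : stepsize M γ t ≤ γ :=
  div_le_self hγ.le (one_le_pow₀ (by norm_num))

lemma stepsize_eq (hM : 100 < M) {t : ℕ} (ht : (t : ℝ) < effSamples M) :
    stepsize M γ t = γ := by
  have := two_le_effSamples hM
  have : ⌊(t : ℝ) / effSamples M⌋₊ = 0 := by
    rw [Nat.floor_eq_zero, div_lt_one (by linarith)]; exact ht
  simp [stepsize, this]

/-- Floors are superadditive, and replacing `⌊t / m⌋` by `t / m` in the exponent costs a factor 2.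
The result is a geometric majorant of the schedule from any time on. -/
lemma stepsize_add_le (hM : 100 < M) (hγ : 0 < γ) (s t : ℕ) :
    stepsize M γ (s + t) ≤ stepsize M γ s * (2 * Real.exp (-(Real.log 2 / effSamples M)) ^ t) := by
  have hm := two_le_effSamples hM
  set m := effSamples M
  have h1 : ⌊(s : ℝ) / m⌋₊ + ⌊(t : ℝ) / m⌋₊ ≤ ⌊((s + t : ℕ) : ℝ) / m⌋₊ := by
    apply Nat.le_floor
    push_cast
    rw [add_div]
    exact add_le_add (Nat.floor_le (by positivity)) (Nat.floor_le (by positivity))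
  have h2 : Real.exp (-(Real.log 2 / m)) ^ t = ((2 : ℝ) ^ ((t : ℝ) / m))⁻¹ := by
    rw [← Real.exp_nat_mul, Real.rpow_def_of_pos (by norm_num), ← Real.exp_neg]
    congr 1; field_simp
  have h3 : (2 : ℝ) ^ ((t : ℝ) / m) ≤ 2 * 2 ^ ⌊(t : ℝ) / m⌋₊ := by
    calc (2 : ℝ) ^ ((t : ℝ) / m) ≤ (2 : ℝ) ^ ((⌊(t : ℝ) / m⌋₊ + 1 : ℕ) : ℝ) := by
          apply Real.rpow_le_rpow_of_exponent_le (by norm_num)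
          push_cast; exact (Nat.lt_floor_add_one _).le
      _ = _ := by rw [Real.rpow_natCast, pow_succ]; ring
  rw [h2]
  unfold stepsize
  calc γ / 2 ^ ⌊((s + t : ℕ) : ℝ) / m⌋₊ ≤ γ / 2 ^ (⌊(s : ℝ) / m⌋₊ + ⌊(t : ℝ) / m⌋₊) := by
        gcongr; norm_num
    _ = γ / 2 ^ ⌊(s : ℝ) / m⌋₊ * (2 ^ ⌊(t : ℝ) / m⌋₊)⁻¹ := by rw [pow_add]; field_simp
    _ ≤ _ := by
        gcongr
        rw [← div_eq_mul_inv, inv_eq_one_div, div_le_div_iff₀ (by positivity) (by positivity)]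
        linarith

/-- The total of the stepsizes from any time on is at most a multiple of `M_eff` times the first
of them. -/
lemma sum_stepsize_le (hM : 100 < M) (hγ : 0 < γ) (s n : ℕ) :
    ∑ k ∈ Finset.Ico s n, stepsize M γ k ≤ 4 * effSamples M * stepsize M γ s := by
  have hm := two_le_effSamples hM
  set m := effSamples M
  have hlog := Real.log_two_gt_d9
  set x := Real.log 2 / m
  have hx : 0 < x := by positivity
  set r := Real.exp (-x)
  have hr1 : 0 < r := Real.exp_pos _
  have hr : r * (1 + x) ≤ 1 := by
    have : r * Real.exp x = 1 := by rw [← Real.exp_add]; simp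
    nlinarith [Real.add_one_le_exp x]
  have hr2 : r < 1 := by nlinarith
  have hgeom : ∑ k ∈ Finset.range (n - s), r ^ k ≤ 1 / (1 - r) := by
    rw [geom_sum_eq hr2.ne, ← neg_div_neg_eq, neg_sub, neg_sub]
    gcongr
    linarith [pow_pos hr1 (n - s)]
  -- `1 + m / log 2 ≤ 1 + 3m/2 ≤ 2m` because `m ≥ 2`; with the factor 2 of the majorant this yields
  -- the constant 4.
  have hb : 1 / (1 - r) ≤ 2 * m := by
    have h1 : 1 / (1 - r) ≤ (1 + x) / x := by
      rw [div_le_div_iff₀ (by linarith) hx]; nlinarith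
    have h2 : (1 + x) / x = 1 + m / Real.log 2 := by simp only [x]; field_simp; ring
    have h3 : m / Real.log 2 ≤ m / (2 / 3) := by gcongr; linarith
    linarith
  rw [Finset.sum_Ico_eq_sum_range]
  have hs := stepsize_pos (M := M) hγ s
  calc _ ≤ ∑ k ∈ Finset.range (n - s), stepsize M γ s * (2 * r ^ k) :=
        Finset.sum_le_sum fun k _ => stepsize_add_le hM hγ s k
    _ = stepsize M γ s * 2 * ∑ k ∈ Finset.range (n - s), r ^ k := by
        rw [Finset.mul_sum]; exact Finset.sum_congr rfl fun _ _ => by ring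
    _ ≤ stepsize M γ s * 2 * (2 * m) := by gcongr; linarith
    _ = _ := by ring

lemma half_effSamples_le_floor (hM : 100 < M) : effSamples M / 2 ≤ ⌊effSamples M⌋₊ := by
  have hm := two_le_effSamples hM
  linarith [Nat.lt_floor_add_one (effSamples M)]

/-- The current step is, after contraction by all later ones, of order at most `1 / M_eff`. -/
lemma stepsize_mul_decay_le (hM : 100 < M) (hγ : 0 < γ) {μ : ℝ} (hμ : 0 < μ)
    (hγμ : γ * μ ≤ 1 / 4) {t : ℕ} :
    stepsize M γ t * μ * decay (stepsize M γ) μ (t + 1) M ≤ 4 / effSamples M := by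
  have hm := two_le_effSamples hM
  have hfl := half_effSamples_le_floor hM
  have hu : ∀ k, stepsize M γ k * μ ≤ 1 / 4 := fun k =>
    (mul_le_mul_of_nonneg_right (stepsize_le hγ k) hμ.le).trans hγμ
  have hu0 : ∀ k, 0 ≤ stepsize M γ k * μ := fun k => mul_nonneg (stepsize_pos hγ k).le hμ.le
  have hM0 : (100 : ℝ) < M := by exact_mod_cast hM
  -- Either `⌊m⌋` further steps remain and contract enough, or `t` is so late that the stepsize
  -- itself is already of order `γ / M`.
  by_cases htM : t + ⌊effSamples M⌋₊ < M
  · have hsum : effSamples M / 4 * stepsize M γ t ≤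
        ∑ k ∈ Finset.Ico (t + 1) M, stepsize M γ k := by
      calc effSamples M / 4 * stepsize M γ t ≤ ⌊effSamples M⌋₊ * (stepsize M γ t / 2) := by
            nlinarith [stepsize_pos (M := M) hγ t]
        _ = ∑ k ∈ Finset.Ico (t + 1) (t + 1 + ⌊effSamples M⌋₊), stepsize M γ t / 2 := by simp
        _ ≤ ∑ k ∈ Finset.Ico (t + 1) (t + 1 + ⌊effSamples M⌋₊), stepsize M γ k := by
            refine Finset.sum_le_sum fun k hk => ?_
            rw [Finset.mem_Ico] at hk
            have hk2 : (k : ℝ) ≤ t + effSamples M := by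
              have : k ≤ t + ⌊effSamples M⌋₊ := by omega
              have h2 : (k : ℝ) ≤ t + ⌊effSamples M⌋₊ := by exact_mod_cast this
              linarith [Nat.floor_le (show 0 ≤ effSamples M by linarith)]
            -- At most one halving occurs within `⌊m⌋` steps.
            have h1 : ⌊(k : ℝ) / effSamples M⌋₊ ≤ ⌊(t : ℝ) / effSamples M⌋₊ + 1 := by
              rw [← Nat.floor_add_one (by positivity)]
              apply Nat.floor_le_floor
              rw [div_add_one (by linarith)]
              gcongr
            unfold stepsize
            calc γ / 2 ^ ⌊(t : ℝ) / effSamples M⌋₊ / 2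
                = γ / 2 ^ (⌊(t : ℝ) / effSamples M⌋₊ + 1) := by rw [pow_succ]; field_simp
              _ ≤ _ := by gcongr; norm_num
        _ ≤ _ := Finset.sum_le_sum_of_subset_of_nonneg
            (Finset.Ico_subset_Ico le_rfl (by omega)) fun k _ _ => (stepsize_pos hγ k).le
    set y := effSamples M / 4 * (stepsize M γ t * μ)
    have h1 : decay (stepsize M γ) μ (t + 1) M ≤ Real.exp (-y) := by
      refine (decay_le_exp hu _ _).trans (Real.exp_le_exp.2 (neg_le_neg ?_))
      simp only [y]; rw [← mul_assoc]; gcongr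
    have h2 : y * Real.exp (-y) ≤ 1 := by
      rw [Real.exp_neg, ← div_eq_mul_inv, div_le_one (Real.exp_pos _)]
      linarith [Real.add_one_le_exp y]
    calc _ ≤ stepsize M γ t * μ * Real.exp (-y) := by gcongr; exact hu0 t
      _ = 4 / effSamples M * (y * Real.exp (-y)) := by simp only [y]; field_simp
      _ ≤ 4 / effSamples M * 1 := by gcongr
      _ = _ := mul_one _
  -- The schedule has `M / m = log₂ M` phases, so more than `log₂ M - 2` halvings have already
  -- occurred and the stepsize is at most `4γ / M`. The phase length `M / log₂ M` is essential here.
  · have h1 : (M : ℝ) / effSamples M - 2 < ⌊(t : ℝ) / effSamples M⌋₊ := by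
      have h2 : (M : ℝ) ≤ t + effSamples M := by
        have : M ≤ t + ⌊effSamples M⌋₊ := by omega
        have h2 : (M : ℝ) ≤ t + ⌊effSamples M⌋₊ := by exact_mod_cast this
        linarith [Nat.floor_le (show 0 ≤ effSamples M by linarith)]
      have h3 : (M : ℝ) / effSamples M ≤ t / effSamples M + 1 := by
        rw [div_add_one (by linarith)]; gcongr
      linarith [Nat.lt_floor_add_one ((t : ℝ) / effSamples M)]
    have hlog : (M : ℝ) / effSamples M = Real.logb 2 M := by
      have := logb_pos hM
      unfold effSamples; field_simp
    have h2 : (M : ℝ) / 4 ≤ 2 ^ ⌊(t : ℝ) / effSamples M⌋₊ := by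
      rw [hlog] at h1
      rw [← Real.rpow_natCast]
      calc (M : ℝ) / 4 = 2 ^ (Real.logb 2 M - 2) := by
            rw [Real.rpow_sub (by norm_num), Real.rpow_logb (by norm_num) (by norm_num)
              (by linarith)]; norm_num
        _ ≤ _ := Real.rpow_le_rpow_of_exponent_le (by norm_num) h1.le
    calc _ ≤ stepsize M γ t * μ * 1 := by gcongr; exacts [hu0 t, decay_le_one hu0 hu _ _]
      _ = γ * μ / 2 ^ ⌊(t : ℝ) / effSamples M⌋₊ := by unfold stepsize; ring
      _ ≤ (1 / 4) / (M / 4) := by gcongr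
      _ ≤ 4 / M := by rw [div_le_div_iff₀ (by positivity) (by positivity)]; linarith
      _ ≤ _ := by gcongr; exact effSamples_le hM

/-- Exactly `⌈m⌉ ≥ m` indices satisfy `k < m`, and all of these steps have size `γ`. -/
lemma mul_effSamples_le_sum (hM : 100 < M) (hγ : 0 < γ) {t : ℕ} (ht : effSamples M ≤ t) :
    γ * effSamples M ≤ ∑ k ∈ Finset.range t, stepsize M γ k := by
  have hm := two_le_effSamples hM
  calc γ * effSamples M ≤ ∑ k ∈ Finset.range ⌈effSamples M⌉₊, γ := by
        simp only [Finset.sum_const, Finset.card_range, nsmul_eq_mul]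
        rw [mul_comm]; gcongr; exact Nat.le_ceil _
    _ = ∑ k ∈ Finset.range ⌈effSamples M⌉₊, stepsize M γ k :=
        Finset.sum_congr rfl fun k hk => (stepsize_eq hM (by
          simpa [Nat.lt_ceil] using hk)).symm
    _ ≤ _ := Finset.sum_le_sum_of_subset_of_nonneg
        (Finset.range_subset_range.2 (Nat.ceil_le.2 ht)) fun k _ _ => (stepsize_pos hγ k).le

end Stepsize

/-! ### Noise accumulated along one eigendirection. -/

section WeightedSums

variable {M : ℕ} {γ μ : ℝ}

lemma stepsize_mul_nonneg (hγ : 0 < γ) (hμ : 0 < μ) (k : ℕ) : 0 ≤ stepsize M γ k * μ :=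
  mul_nonneg (stepsize_pos hγ k).le hμ.le

lemma stepsize_mul_le (hγ : 0 < γ) (hμ : 0 < μ) (hγμ : γ * μ ≤ 1 / 4) (k : ℕ) :
    stepsize M γ k * μ ≤ 1 / 4 :=
  (mul_le_mul_of_nonneg_right (stepsize_le hγ k) hμ.le).trans hγμ

variable {q : ℕ → ℝ} {Q : ℝ}

/-- Contraction is discarded and one stepsize factor is bounded by `γ`, so the mean bound on `q`
suffices. -/
lemma weightedSum_le_tail (hγ : 0 < γ) (hμ : 0 < μ)
    (hγμ : γ * μ ≤ 1 / 4) (hq : ∀ t, 0 ≤ q t)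
    (hsum : ∑ t ∈ Finset.range M, stepsize M γ t * q t ≤ 2 * Q) :
    ∑ t ∈ Finset.range M, stepsize M γ t ^ 2 * q t * (μ * decay (stepsize M γ) μ (t + 1) M ^ 2) ≤
      2 * γ * μ * Q := by
  have hu0 := stepsize_mul_nonneg (M := M) hγ hμ
  have hu := stepsize_mul_le (M := M) hγ hμ hγμ
  calc _ ≤ ∑ t ∈ Finset.range M, γ * μ * (stepsize M γ t * q t) := by
        refine Finset.sum_le_sum fun t _ => ?_
        have h1 := stepsize_pos (M := M) hγ t
        calc _ ≤ stepsize M γ t ^ 2 * q t * (μ * 1) := by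
              gcongr
              · exact mul_nonneg (sq_nonneg _) (hq t)
              · exact decay_sq_le_one hu0 hu _ _
          _ = stepsize M γ t * μ * (stepsize M γ t * q t) := by ring
          _ ≤ _ := by
              have := mul_nonneg h1.le (hq t)
              gcongr
              exact stepsize_le hγ t
    _ = γ * μ * ∑ t ∈ Finset.range M, stepsize M γ t * q t := by rw [Finset.mul_sum]
    _ ≤ γ * μ * (2 * Q) := by gcongr
    _ = _ := by ring

/-- Each term is `q t / μ` times the square of `η_t μ` times the later contraction, a quantity at
most `4 / m`. The constant is `44 = 16 · 2 + 12`: the mean bound in the first phase plus the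
pointwise bound afterwards. -/
lemma weightedSum_le_head (hM : 100 < M) (hγ : 0 < γ) (hμ : 0 < μ)
    (hγμ : γ * μ ≤ 1 / 4) (hq : ∀ t, 0 ≤ q t)
    (hsum : ∑ t ∈ Finset.range M, stepsize M γ t * q t ≤ 2 * Q)
    (hpt : ∀ t < M, (∑ k ∈ Finset.range t, stepsize M γ k) * q t ≤ 3 * Q) :
    ∑ t ∈ Finset.range M, stepsize M γ t ^ 2 * q t * (μ * decay (stepsize M γ) μ (t + 1) M ^ 2) ≤
      44 * Q / (γ * μ * effSamples M ^ 2) := by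
  have hu0 := stepsize_mul_nonneg (M := M) hγ hμ
  have hu := stepsize_mul_le (M := M) hγ hμ hγμ
  have hm := two_le_effSamples hM
  set m := effSamples M
  have hd := fun t => decay_nonneg hu (t + 1) M
  have hQ : 0 ≤ Q := by
    have := Finset.sum_nonneg fun t (_ : t ∈ Finset.range M) =>
      mul_nonneg (stepsize_pos (M := M) hγ t).le (hq t)
    linarith
  have hterm : ∀ t ∈ Finset.range M,
      stepsize M γ t ^ 2 * q t * (μ * decay (stepsize M γ) μ (t + 1) M ^ 2) ≤
      16 / (γ * μ * m ^ 2) * (stepsize M γ t * q t) +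
        12 * Q / (γ * μ * m ^ 2) * (stepsize M γ t * μ * decay (stepsize M γ) μ (t + 1) M) := by
    intro t ht
    have hs := stepsize_pos (M := M) hγ t
    have hk := stepsize_mul_decay_le hM hγ hμ hγμ (t := t)
    have hy0 : 0 ≤ stepsize M γ t * μ * decay (stepsize M γ) μ (t + 1) M :=
      mul_nonneg (hu0 t) (hd t)
    set d := decay (stepsize M γ) μ (t + 1) M
    -- In the first phase `η_t = γ`, both contracted factors are bounded by `4 / m`, and `η_t q_t`
    -- is kept for the mean bound. Afterwards `q t ≤ 3Q / (γ m)`, and one contracted factor is kept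
    -- for the telescoping sum.
    by_cases h : (t : ℝ) < m
    · have hst : stepsize M γ t = γ := stepsize_eq hM h
      have hq' := hq t
      calc _ = stepsize M γ t * q t / (γ * μ) * (stepsize M γ t * μ * d) ^ 2 := by
            rw [hst]; field_simp
        _ ≤ stepsize M γ t * q t / (γ * μ) * (4 / m) ^ 2 := by gcongr
        _ = 16 / (γ * μ * m ^ 2) * (stepsize M γ t * q t) := by field_simp; norm_num
        _ ≤ _ := le_add_of_nonneg_right (by positivity)
    · have hq' : q t ≤ 3 * Q / (γ * m) := by
        rw [le_div_iff₀ (by positivity), mul_comm]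
        refine (mul_le_mul_of_nonneg_right ?_ (hq t)).trans (hpt t (Finset.mem_range.1 ht))
        exact mul_effSamples_le_sum hM hγ (not_lt.1 h)
      have hq0 := hq t
      calc _ = q t / μ * (stepsize M γ t * μ * d) * (stepsize M γ t * μ * d) := by
            field_simp
        _ ≤ (3 * Q / (γ * m)) / μ * (4 / m) * (stepsize M γ t * μ * d) := by gcongr
        _ = 12 * Q / (γ * μ * m ^ 2) * (stepsize M γ t * μ * d) := by field_simp; ring
        _ ≤ _ := le_add_of_nonneg_left (by positivity)
  calc _ ≤ _ := Finset.sum_le_sum hterm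
    _ = 16 / (γ * μ * m ^ 2) * (∑ t ∈ Finset.range M, stepsize M γ t * q t) +
        12 * Q / (γ * μ * m ^ 2) * (1 - decay (stepsize M γ) μ 0 M) := by
        rw [Finset.sum_add_distrib, ← Finset.mul_sum, ← Finset.mul_sum, sum_mul_decay_eq]
    _ ≤ 16 / (γ * μ * m ^ 2) * (2 * Q) + 12 * Q / (γ * μ * m ^ 2) * 1 := by
        gcongr
        linarith [decay_nonneg hu 0 M]
    _ = _ := by field_simp; norm_num

/-- All stepsizes from `s` on total at most `4 m η_s`. The exponent is 16 = 4 · 2 · 2: this factor,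
the 2 of `exp_le_decay`, and the square. -/
lemma exp_le_decay_sq (hM : 100 < M) (hγ : 0 < γ) (hμ : 0 < μ) (hγμ : γ * μ ≤ 1 / 4)
    {c : ℝ} {s : ℕ} (h : effSamples M * (stepsize M γ s * μ) ≤ c) (t : ℕ) :
    Real.exp (-16 * c) ≤ decay (stepsize M γ) μ s t ^ 2 := by
  have hu0 := stepsize_mul_nonneg (M := M) hγ hμ
  have hu := stepsize_mul_le (M := M) hγ hμ hγμ
  have h1 := exp_le_decay hu0 hu s t
  have h2 := sum_stepsize_le hM hγ s t
  calc Real.exp (-16 * c)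
      ≤ Real.exp (-2 * ((∑ k ∈ Finset.Ico s t, stepsize M γ k) * μ)) ^ 2 := by
        rw [← Real.exp_nat_mul]
        apply Real.exp_le_exp.2
        push_cast
        nlinarith [mul_le_mul_of_nonneg_right h2 hμ.le]
    _ ≤ _ := by gcongr

/-- The steps of size `γ` in the first phase are enough, since nothing is contracted by more than a
constant. -/
lemma le_weightedSum_tail (hM : 100 < M) (hγ : 0 < γ) (hμ : 0 < μ) (hγμ : γ * μ ≤ 1 / 4)
    (h : γ * μ * effSamples M ≤ 1) :
    Real.exp (-16) * (effSamples M * γ ^ 2 * μ) ≤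
      ∑ t ∈ Finset.range M, stepsize M γ t ^ 2 * (μ * decay (stepsize M γ) μ (t + 1) M ^ 2) := by
  have hm := two_le_effSamples hM
  have hd : ∀ t, Real.exp (-16) ≤ decay (stepsize M γ) μ (t + 1) M ^ 2 := fun t => by
    have := exp_le_decay_sq hM hγ hμ hγμ (c := 1) (s := t + 1) ?_ M
    · simpa using this
    · have := stepsize_le (M := M) hγ (t + 1)
      calc _ ≤ effSamples M * (γ * μ) := by gcongr
        _ ≤ 1 := by linarith
  have hsum : effSamples M * γ ^ 2 ≤ ∑ t ∈ Finset.range M, stepsize M γ t ^ 2 := by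
    calc effSamples M * γ ^ 2 ≤ ∑ t ∈ Finset.range ⌈effSamples M⌉₊, γ ^ 2 := by
          simp only [Finset.sum_const, Finset.card_range, nsmul_eq_mul]
          gcongr; exact Nat.le_ceil _
      _ = ∑ t ∈ Finset.range ⌈effSamples M⌉₊, stepsize M γ t ^ 2 :=
          Finset.sum_congr rfl fun k hk => by
            rw [stepsize_eq hM (by simpa [Nat.lt_ceil] using hk)]
      _ ≤ _ := Finset.sum_le_sum_of_subset_of_nonneg
          (Finset.range_subset_range.2 (Nat.ceil_le.2 (effSamples_le hM)))
          fun k _ _ => sq_nonneg _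
  calc _ = effSamples M * γ ^ 2 * (μ * Real.exp (-16)) := by ring
    _ ≤ (∑ t ∈ Finset.range M, stepsize M γ t ^ 2) * (μ * Real.exp (-16)) := by gcongr
    _ = ∑ t ∈ Finset.range M, stepsize M γ t ^ 2 * (μ * Real.exp (-16)) := by
        rw [Finset.sum_mul]
    _ ≤ _ := by gcongr; exact hd _

lemma le_weightedSum_head (hM : 100 < M) (hγ : 0 < γ) (hμ : 0 < μ) (hγμ : γ * μ ≤ 1 / 4)
    (h : 1 ≤ γ * μ * effSamples M) :
    Real.exp (-32) / 2 * (1 / (μ * effSamples M)) ≤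
      ∑ t ∈ Finset.range M, stepsize M γ t ^ 2 * (μ * decay (stepsize M γ) μ (t + 1) M ^ 2) := by
  have hm := two_le_effSamples hM
  have hM0 : (100 : ℝ) < M := by exact_mod_cast hM
  set m := effSamples M
  -- Phase `l` is the one where `γ / 2^l * μ * m` lies in `[1, 2)`: the step is large enough to
  -- inject noise of order `1 / (m μ)`, yet the contraction from there on is bounded below.
  obtain ⟨l, hl1, hl2⟩ := exists_nat_pow_near h (one_lt_two (α := ℝ))
  -- Phase `l` is completed before time `M`: `γ μ ≤ 1/4` gives `2^(l+1) ≤ m ≤ M`, and there are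
  -- `log₂ M` phases.
  have hlM : ((l + 1 : ℕ) : ℝ) * m ≤ M := by
    have h1 : (2 : ℝ) ^ (l + 1) ≤ M := by
      have : (2 : ℝ) ^ (l + 1) ≤ m := by rw [pow_succ]; nlinarith
      exact this.trans (effSamples_le hM)
    have h2 : ((l + 1 : ℕ) : ℝ) ≤ Real.logb 2 M := by
      rw [Real.le_logb_iff_rpow_le (by norm_num) (by linarith), Real.rpow_natCast]; exact h1
    have h3 : Real.logb 2 M * m = M := by
      have := logb_pos hM
      simp only [m]; unfold effSamples; field_simp
    rw [← h3]; gcongr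
  set t₀ := ⌈(l : ℝ) * m⌉₊
  have ht0 : (l : ℝ) * m ≤ t₀ := Nat.le_ceil _
  have ht1 : (t₀ : ℝ) < l * m + 1 := Nat.ceil_lt_add_one (by positivity)
  have hphase : ∀ t ∈ Finset.Ico t₀ (t₀ + ⌊m⌋₊), stepsize M γ t = γ / 2 ^ l ∧ t < M := by
    intro t ht
    rw [Finset.mem_Ico] at ht
    have h1 : (t₀ : ℝ) ≤ t := by exact_mod_cast ht.1
    -- The `+ 1` pays for the ceiling in `t₀`, so that `t < (l + 1) m`.
    have h2 : (t : ℝ) + 1 ≤ t₀ + m := by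
      have : (t : ℝ) + 1 ≤ t₀ + ⌊m⌋₊ := by exact_mod_cast ht.2
      linarith [Nat.floor_le (show 0 ≤ m by linarith)]
    have h3 : ⌊(t : ℝ) / m⌋₊ = l := by
      rw [Nat.floor_eq_iff (by positivity)]
      constructor
      · rw [le_div_iff₀ (by linarith)]; linarith
      · rw [div_lt_iff₀ (by linarith)]; linarith
    refine ⟨by unfold stepsize; rw [h3], ?_⟩
    have : (t : ℝ) < M := by push_cast at hlM; linarith
    exact_mod_cast this
  have hx1 : 1 ≤ γ / 2 ^ l * μ * m := by
    rw [show γ / 2 ^ l * μ * m = γ * μ * m / 2 ^ l by ring, le_div_iff₀ (by positivity)]; linarith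
  have hx2 : γ / 2 ^ l * μ * m ≤ 2 := by
    rw [show γ / 2 ^ l * μ * m = γ * μ * m / 2 ^ l by ring, div_le_iff₀ (by positivity)]
    rw [pow_succ] at hl2; linarith
  have hfl := half_effSamples_le_floor hM
  calc Real.exp (-32) / 2 * (1 / (μ * m)) ≤
        Real.exp (-32) / 2 * ((γ / 2 ^ l * μ * m) ^ 2 / (μ * m)) := by
          gcongr; exact one_le_pow₀ hx1
    _ = m / 2 * ((γ / 2 ^ l) ^ 2 * (μ * Real.exp (-32))) := by field_simp
    _ ≤ ⌊m⌋₊ * ((γ / 2 ^ l) ^ 2 * (μ * Real.exp (-32))) := by gcongr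
    _ = ∑ t ∈ Finset.Ico t₀ (t₀ + ⌊m⌋₊), (γ / 2 ^ l) ^ 2 * (μ * Real.exp (-32)) := by simp
    _ ≤ ∑ t ∈ Finset.Ico t₀ (t₀ + ⌊m⌋₊),
          stepsize M γ t ^ 2 * (μ * decay (stepsize M γ) μ (t + 1) M ^ 2) := by
        refine Finset.sum_le_sum fun t ht => ?_
        rw [(hphase t ht).1]
        gcongr
        have := exp_le_decay_sq hM hγ hμ hγμ (c := 2) (s := t + 1) ?_ M
        · norm_num at this ⊢; exact this
        · have := (stepsize_antitone hM hγ (Nat.le_succ t)).trans_eq (hphase t ht).1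
          calc _ ≤ m * (γ / 2 ^ l * μ) := by gcongr
            _ ≤ 2 := by linarith
    _ ≤ _ := Finset.sum_le_sum_of_subset_of_nonneg
        (fun t ht => Finset.mem_range.2 (hphase t ht).2)
        fun t _ _ => mul_nonneg (sq_nonneg _) (mul_nonneg hμ.le (sq_nonneg _))

end WeightedSums

/-! ### A discrete Volterra inequality. -/

/-- A Volterra inequality with a small kernel: the solution is controlled, both in the mean and
pointwise, by its forcing term. -/
lemma volterra_bounds {M : ℕ} {γ α T Q : ℝ} {η q p : ℕ → ℝ} {K : ℕ → ℕ → ℝ}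
    (hη : ∀ t, 0 ≤ η t) (hηγ : ∀ t, η t ≤ γ) (hα : 0 ≤ α) (hT : 4 * α * γ * T ≤ 1)
    (hq : ∀ t, 0 ≤ q t) (hK : ∀ t s, 0 ≤ K t s) (hQ : 0 ≤ Q)
    (hrec : ∀ s < M, q s ≤ p s + 2 * α * ∑ t ∈ Finset.range s, η t ^ 2 * q t * K t s)
    (hsum : ∑ t ∈ Finset.range M, η t * p t ≤ Q)
    (hpt : ∀ s < M, (∑ k ∈ Finset.range s, η k) * p s ≤ Q)
    (hK1 : ∀ s, ∑ t ∈ Finset.range s, η t * K t s ≤ T)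
    (hK2 : ∀ t < M, ∑ s ∈ Finset.Ico (t + 1) M, η s * K t s ≤ T)
    (hK3 : ∀ t s, t < s → (∑ k ∈ Finset.Ico t s, η k) * K t s ≤ T / 2) :
    ∑ t ∈ Finset.range M, η t * q t ≤ 2 * Q ∧
      ∀ s < M, (∑ k ∈ Finset.range s, η k) * q s ≤ 3 * Q := by
  have hT0 : 0 ≤ T := by simpa using hK1 0
  have hηq := fun t => mul_nonneg (hη t) (hq t)
  have hS : ∑ t ∈ Finset.range M, η t * q t ≤ 2 * Q := by
    set S := ∑ t ∈ Finset.range M, η t * q t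
    have hS0 : 0 ≤ S := Finset.sum_nonneg fun t _ => hηq t
    -- Exchanging the two sums leaves the kernel summed over its later time, hence `T`. As `2 α γ T
    -- ≤ 1/2`, the term in `S` is absorbed on the left.
    have h1 : S ≤ Q + 2 * α * (γ * T * S) := by
      calc S ≤ ∑ s ∈ Finset.range M, η s * (p s + 2 * α *
              ∑ t ∈ Finset.range s, η t ^ 2 * q t * K t s) :=
            Finset.sum_le_sum fun s hs =>
              mul_le_mul_of_nonneg_left (hrec s (Finset.mem_range.1 hs)) (hη s)
        _ = ∑ s ∈ Finset.range M, η s * p s + 2 * α * ∑ s ∈ Finset.range M,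
              ∑ t ∈ Finset.range s, η s * (η t ^ 2 * q t * K t s) := by
            rw [Finset.mul_sum, ← Finset.sum_add_distrib]
            refine Finset.sum_congr rfl fun s _ => ?_
            rw [← Finset.mul_sum]; ring
        _ = ∑ s ∈ Finset.range M, η s * p s + 2 * α * ∑ t ∈ Finset.range M,
              η t ^ 2 * q t * ∑ s ∈ Finset.Ico (t + 1) M, η s * K t s := by
            congr 2
            rw [Finset.sum_comm' (s' := fun t => Finset.Ico (t + 1) M) (t' := Finset.range M)]
            · refine Finset.sum_congr rfl fun t _ => ?_
              rw [Finset.mul_sum]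
              exact Finset.sum_congr rfl fun s _ => by ring
            · intro s t; simp only [Finset.mem_range, Finset.mem_Ico]; omega
        _ ≤ Q + 2 * α * ∑ t ∈ Finset.range M, γ * T * (η t * q t) := by
            refine add_le_add hsum (mul_le_mul_of_nonneg_left
              (Finset.sum_le_sum fun t ht => ?_) (by positivity))
            calc _ ≤ η t ^ 2 * q t * T :=
                  mul_le_mul_of_nonneg_left (hK2 t (Finset.mem_range.1 ht))
                    (mul_nonneg (sq_nonneg _) (hq t))
              _ = η t * T * (η t * q t) := by ring
              _ ≤ _ := mul_le_mul_of_nonneg_right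
                  (mul_le_mul_of_nonneg_right (hηγ t) hT0) (hηq t)
        _ = _ := by rw [← Finset.mul_sum]
    nlinarith
  refine ⟨hS, fun s => ?_⟩
  induction s using Nat.strong_induction_on with
  | _ s ih =>
    intro hs
    set Γ : ℕ → ℝ := fun n => ∑ k ∈ Finset.range n, η k with hΓ
    change Γ s * q s ≤ 3 * Q
    have hΓ0 : 0 ≤ Γ s := Finset.sum_nonneg fun k _ => hη k
    -- `Γ s` splits at `t`: the part after `t` is absorbed by the kernel, the part before `t` meets
    -- the induction hypothesis.
    have hterm : ∀ t ∈ Finset.range s, Γ s * (η t ^ 2 * q t * K t s) ≤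
        γ * T / 2 * (η t * q t) + γ * (3 * Q) * (η t * K t s) := by
      intro t ht
      rw [Finset.mem_range] at ht
      have h1 : Γ s = ∑ k ∈ Finset.Ico t s, η k + Γ t := by
        rw [add_comm]; exact (Finset.sum_range_add_sum_Ico _ ht.le).symm
      have h2 := hK3 t s ht
      have h3 : Γ t * q t ≤ 3 * Q := ih t ht (ht.trans hs)
      calc _ = η t * (η t * q t) * ((∑ k ∈ Finset.Ico t s, η k) * K t s) +
            η t * (η t * K t s) * (Γ t * q t) := by rw [h1]; ring
        _ ≤ γ * (η t * q t) * (T / 2) + γ * (η t * K t s) * (3 * Q) := by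
            have h4 := hηq t
            have h5 := mul_nonneg (hη t) (hK t s)
            have h6 := hηγ t
            have h7 : 0 ≤ γ := (hη t).trans h6
            have h8 := hη t
            have h9 : 0 ≤ Γ t * q t := mul_nonneg (Finset.sum_nonneg fun k _ => hη k) (hq t)
            have h10 : 0 ≤ (∑ k ∈ Finset.Ico t s, η k) * K t s :=
              mul_nonneg (Finset.sum_nonneg fun k _ => hη k) (hK t s)
            gcongr
        _ = _ := by ring
    have hγ0 : 0 ≤ γ := (hη 0).trans (hηγ 0)
    calc Γ s * q s ≤ Γ s * (p s + 2 * α * ∑ t ∈ Finset.range s, η t ^ 2 * q t * K t s) := by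
          gcongr; exact hrec s hs
      _ = Γ s * p s + 2 * α * ∑ t ∈ Finset.range s, Γ s * (η t ^ 2 * q t * K t s) := by
          rw [← Finset.mul_sum]; ring
      _ ≤ Q + 2 * α * ∑ t ∈ Finset.range s,
            (γ * T / 2 * (η t * q t) + γ * (3 * Q) * (η t * K t s)) := by
          gcongr with t ht
          · exact hpt s hs
          · exact hterm t ht
      _ = Q + 2 * α * (γ * T / 2 * ∑ t ∈ Finset.range s, η t * q t +
            γ * (3 * Q) * ∑ t ∈ Finset.range s, η t * K t s) := by
          rw [Finset.sum_add_distrib, Finset.mul_sum, Finset.mul_sum]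
      _ ≤ Q + 2 * α * (γ * T / 2 * (2 * Q) + γ * (3 * Q) * T) := by
          gcongr
          · refine le_trans ?_ hS
            exact Finset.sum_le_sum_of_subset_of_nonneg (Finset.range_subset_range.2 hs.le)
              fun t _ _ => hηq t
          · exact hK1 s
      -- The total is `Q + 8 α γ T Q`, which the smallness condition turns into exactly `3 Q`.
      _ ≤ 3 * Q := by nlinarith

/-! ### Second moment operators and traces. -/

section SecondMoment

variable {E : Type*} [NormedAddCommGroup E] [InnerProductSpace ℝ E]

lemma outer_apply (x v : E) : outer x v = ⟪x, v⟫ • x := rfl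

lemma inner_outer (u x v : E) : ⟪u, outer x v⟫ = ⟪x, u⟫ * ⟪x, v⟫ := by
  rw [outer_apply, inner_smul_right, real_inner_comm x u, mul_comm]

lemma continuous_outer : Continuous (outer : E → E →L[ℝ] E) := by
  unfold outer
  exact ((InnerProductSpace.rankOne ℝ (E := E) (F := E)).continuous).clm_apply continuous_id

lemma norm_outer (x : E) : ‖outer x‖ = ‖x‖ ^ 2 := by
  rw [outer, InnerProductSpace.norm_rankOne, sq]

lemma abs_inner_apply_le (A : E →L[ℝ] E) (x y : E) : |⟪x, A y⟫| ≤ ‖A‖ * (‖x‖ * ‖y‖) :=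
  (abs_real_inner_le_norm _ _).trans <|
    (mul_le_mul_of_nonneg_left (A.le_opNorm y) (norm_nonneg _)).trans_eq (by ring)

/-- Basis vectors lie at mutual distance `√2`. Countability permits exchanging basis sums with
integrals. -/
lemma countable_of_hilbertBasis [SecondCountableTopology E] {ι : Type*}
    (b : HilbertBasis ι ℝ E) : Countable ι := by
  refine Pairwise.countable_of_isOpen_disjoint (s := fun i => Metric.ball (b i) (1 / 2)) ?_
    (fun i => Metric.isOpen_ball) fun i => ⟨b i, Metric.mem_ball_self (by norm_num)⟩
  intro i j hij
  refine Metric.ball_disjoint_ball ?_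
  have h1 : ‖b i - b j‖ ^ 2 = 2 := by
    rw [@norm_sub_sq_real, b.orthonormal.1, b.orthonormal.1, b.orthonormal.2 hij]; norm_num
  rw [dist_eq_norm]
  nlinarith [norm_nonneg (b i - b j)]

variable [CompleteSpace E] [SecondCountableTopology E] [MeasurableSpace E] [BorelSpace E]
  {D : Measure (E × ℝ)}

lemma integrable_outer (h : Integrable (fun p : E × ℝ => ‖p.1‖ ^ 2) D) :
    Integrable (fun p : E × ℝ => outer p.1) D :=
  h.mono (continuous_outer.comp continuous_fst).aestronglyMeasurable
    (.of_forall fun p => by simp [norm_outer])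

lemma integral_inner_apply {F : E × ℝ → E →L[ℝ] E} (hF : Integrable F D) (u v : E) :
    ⟪u, (∫ p, F p ∂D) v⟫ = ∫ p, ⟪u, F p v⟫ ∂D := by
  rw [ContinuousLinearMap.integral_apply hF, ← integral_inner (hF.apply_continuousLinearMap v)]

lemma inner_secondMoment (h : Integrable (fun p : E × ℝ => ‖p.1‖ ^ 2) D) (u v : E) :
    ⟪u, secondMoment D v⟫ = ∫ p, ⟪p.1, u⟫ * ⟪p.1, v⟫ ∂D := by
  rw [secondMoment, integral_inner_apply (integrable_outer h)]
  simp_rw [inner_outer]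

lemma integrable_inner_mul_inner (h : Integrable (fun p : E × ℝ => ‖p.1‖ ^ 2) D) (u v : E) :
    Integrable (fun p : E × ℝ => ⟪p.1, u⟫ * ⟪p.1, v⟫) D := by
  simp_rw [← inner_outer]
  exact ((integrable_outer h).apply_continuousLinearMap v).const_inner u

lemma secondMoment_isPositive (h : Integrable (fun p : E × ℝ => ‖p.1‖ ^ 2) D) :
    (secondMoment D).IsPositive := by
  rw [ContinuousLinearMap.isPositive_iff]
  refine ⟨fun u v => ?_, fun u => ?_⟩
  · change ⟪secondMoment D u, v⟫ = ⟪u, secondMoment D v⟫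
    rw [real_inner_comm, inner_secondMoment h, inner_secondMoment h]
    simp_rw [mul_comm]
  · rw [real_inner_comm, inner_secondMoment h]
    exact integral_nonneg fun p => mul_self_nonneg _

/-- `tr(𝔼[x xᵀ] A) = 𝔼⟪x, A x⟫`, the trace being computed in any orthonormal basis. -/
lemma hasSum_inner_secondMoment_comp (h : Integrable (fun p : E × ℝ => ‖p.1‖ ^ 2) D)
    (A : E →L[ℝ] E) {ι : Type*} (b : HilbertBasis ι ℝ E) :
    HasSum (fun i => ⟪b i, secondMoment D (A (b i))⟫) (∫ p, ⟪p.1, A p.1⟫ ∂D) := by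
  have := countable_of_hilbertBasis b
  simp_rw [inner_secondMoment h]
  set B := ContinuousLinearMap.adjoint A
  have hB : ∀ x i, ⟪x, A (b i)⟫ = ⟪B x, b i⟫ := fun x i =>
    (ContinuousLinearMap.adjoint_inner_left A (b i) x).symm
  have hsq : ∀ x : E, HasSum (fun i => ⟪x, b i⟫ ^ 2) (‖x‖ ^ 2) := fun x => by
    have := b.hasSum_inner_mul_inner x x
    rw [real_inner_self_eq_norm_sq] at this
    refine this.congr_fun (fun i => ?_)
    rw [real_inner_comm x (b i), sq]
  have hbound : ∀ x : E, HasSum (fun i => (⟪x, b i⟫ ^ 2 + ⟪B x, b i⟫ ^ 2) / 2)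
      ((‖x‖ ^ 2 + ‖B x‖ ^ 2) / 2) := fun x => ((hsq x).add (hsq (B x))).div_const 2
  -- `|⟪x, b i⟫ ⟪B x, b i⟫|` is dominated by the half sum of squares, whose sum over `i` is `(‖x‖² +
  -- ‖B x‖²) / 2` by Parseval.
  refine hasSum_integral_of_dominated_convergence
    (fun i p => (⟪p.1, b i⟫ ^ 2 + ⟪B p.1, b i⟫ ^ 2) / 2) (fun i => by fun_prop)
    (fun i => .of_forall fun p => ?_) (.of_forall fun p => (hbound p.1).summable) ?_
    (.of_forall fun p => ?_)
  · rw [hB, Real.norm_eq_abs, abs_le]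
    constructor <;> nlinarith [sq_nonneg (⟪p.1, b i⟫ + ⟪B p.1, b i⟫),
      sq_nonneg (⟪p.1, b i⟫ - ⟪B p.1, b i⟫)]
  · simp_rw [fun p : E × ℝ => (hbound p.1).tsum_eq]
    refine (h.const_mul ((1 + ‖B‖ ^ 2) / 2)).mono' (by fun_prop) (.of_forall fun p => ?_)
    rw [Real.norm_of_nonneg (by positivity)]
    have := pow_le_pow_left₀ (norm_nonneg _) (B.le_opNorm p.1) 2
    rw [mul_pow] at this
    linarith
  · have := b.hasSum_inner_mul_inner (B p.1) p.1
    rw [ContinuousLinearMap.adjoint_inner_left] at this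
    refine this.congr_fun (fun i => ?_)
    rw [hB, real_inner_comm p.1 (b i), mul_comm]

lemma trace_secondMoment_comp (h : Integrable (fun p : E × ℝ => ‖p.1‖ ^ 2) D)
    (A : E →L[ℝ] E) : trace (secondMoment D ∘L A) = ∫ p, ⟪p.1, A p.1⟫ ∂D :=
  (hasSum_inner_secondMoment_comp h A _).tsum_eq

lemma trace_secondMoment (h : Integrable (fun p : E × ℝ => ‖p.1‖ ^ 2) D) :
    trace (secondMoment D) = ∫ p, ‖p.1‖ ^ 2 ∂D := by
  have := trace_secondMoment_comp h (ContinuousLinearMap.id ℝ E)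
  simpa using this

end SecondMoment

/-! ### Congruences of positive operators. -/

section Congruence

variable {E : Type*} [NormedAddCommGroup E] [InnerProductSpace ℝ E] [CompleteSpace E]

/-- The congruence `Tᵀ A T`. -/
def conj (T A : E →L[ℝ] E) : E →L[ℝ] E := ContinuousLinearMap.adjoint T ∘L A ∘L T

lemma inner_conj (T A : E →L[ℝ] E) (u v : E) : ⟪u, conj T A v⟫ = ⟪T u, A (T v)⟫ :=
  ContinuousLinearMap.adjoint_inner_right T u (A (T v))

lemma conj_isPositive (T : E →L[ℝ] E) {A : E →L[ℝ] E} (hA : A.IsPositive) :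
    (conj T A).IsPositive := by
  rw [ContinuousLinearMap.isPositive_iff]
  refine ⟨fun u v => ?_, fun u => ?_⟩
  · change ⟪conj T A u, v⟫ = ⟪u, conj T A v⟫
    rw [real_inner_comm, inner_conj, inner_conj, real_inner_comm, hA.inner_left_eq_inner_right]
  · rw [real_inner_comm, inner_conj]; exact hA.inner_nonneg_right _

lemma inner_apply_le_of_le {S T : E →L[ℝ] E} (h : S ≤ T) (u : E) : ⟪u, S u⟫ ≤ ⟪u, T u⟫ := by
  have := (ContinuousLinearMap.le_def S T).1 h |>.inner_nonneg_right u
  rw [sub_apply, inner_sub_right] at this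
  linarith

lemma sqNorm_nonneg {A : E →L[ℝ] E} (hA : A.IsPositive) (u : E) : 0 ≤ sqNorm A u :=
  hA.inner_nonneg_right u

end Congruence

/-! ### The expected energy after one SGD step. -/

section OneStep

variable {E : Type*} [NormedAddCommGroup E] [InnerProductSpace ℝ E]
  [CompleteSpace E] [SecondCountableTopology E] [MeasurableSpace E] [BorelSpace E]
  {D : Measure (E × ℝ)} {wStar : E}

lemma FiniteSecondMoments.integrable_residual_sq (h : FiniteSecondMoments D) (w : E) :
    Integrable (fun p : E × ℝ => (p.2 - ⟪w, p.1⟫) ^ 2) D := by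
  refine ((h.response.const_mul 2).add (h.covariate.const_mul (2 * ‖w‖ ^ 2))).mono'
    (by fun_prop) (.of_forall fun p => ?_)
  have h1 : ⟪w, p.1⟫ ^ 2 ≤ (‖w‖ * ‖p.1‖) ^ 2 :=
    sq_le_sq.2 ((abs_real_inner_le_norm _ _).trans (le_abs_self _))
  rw [Real.norm_of_nonneg (sq_nonneg _), Pi.add_apply]
  nlinarith [sq_nonneg (p.2 + ⟪w, p.1⟫)]

lemma FiniteSecondMoments.integrable_residual_mul (h : FiniteSecondMoments D) (w u : E) :
    Integrable (fun p : E × ℝ => (p.2 - ⟪w, p.1⟫) * ⟪p.1, u⟫) D := by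
  refine ((h.integrable_residual_sq w).add (h.covariate.const_mul (‖u‖ ^ 2))).mono'
    (by fun_prop) (.of_forall fun p => ?_)
  have h1 : ⟪p.1, u⟫ ^ 2 ≤ (‖p.1‖ * ‖u‖) ^ 2 :=
    sq_le_sq.2 ((abs_real_inner_le_norm _ _).trans (le_abs_self _))
  rw [Real.norm_eq_abs, abs_le, Pi.add_apply]
  constructor <;> nlinarith [sq_nonneg (p.2 - ⟪w, p.1⟫ + ⟪p.1, u⟫),
    sq_nonneg (p.2 - ⟪w, p.1⟫ - ⟪p.1, u⟫), sq_nonneg (p.2 - ⟪w, p.1⟫), sq_nonneg ⟪p.1, u⟫]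

lemma FiniteSecondMoments.risk_sub (h : FiniteSecondMoments D) (w u : E) :
    risk D (w + u) - risk D w =
      (1 / 2) * ⟪u, secondMoment D u⟫ - ∫ p, (p.2 - ⟪w, p.1⟫) * ⟪p.1, u⟫ ∂D := by
  have h1 := h.integrable_residual_sq w
  have h2 := h.integrable_residual_mul w u
  have h3 := integrable_inner_mul_inner h.covariate u u
  have : ∀ p : E × ℝ, (p.2 - ⟪w + u, p.1⟫) ^ 2 = (p.2 - ⟪w, p.1⟫) ^ 2 -
      2 * ((p.2 - ⟪w, p.1⟫) * ⟪p.1, u⟫) + ⟪p.1, u⟫ * ⟪p.1, u⟫ := fun p => by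
    rw [inner_add_left, real_inner_comm p.1 u]; ring
  rw [risk, risk, inner_secondMoment h.covariate]
  have h12 : Integrable (fun p : E × ℝ => (p.2 - ⟪w, p.1⟫) ^ 2 -
      2 * ((p.2 - ⟪w, p.1⟫) * ⟪p.1, u⟫)) D := h1.sub (h2.const_mul 2)
  simp_rw [this]
  rw [integral_add h12 h3, integral_sub h1 (h2.const_mul 2), integral_const_mul]
  ring

/-- The residual at a risk minimizer is uncorrelated with the covariate. -/
lemma FiniteSecondMoments.integral_residual_mul_eq_zero (h : FiniteSecondMoments D)
    (hmin : ∀ w, risk D wStar ≤ risk D w) (u : E) :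
    ∫ p, (p.2 - ⟪wStar, p.1⟫) * ⟪p.1, u⟫ ∂D = 0 := by
  set a := ∫ p, (p.2 - ⟪wStar, p.1⟫) * ⟪p.1, u⟫ ∂D with ha
  set b := ⟪u, secondMoment D u⟫ with hb
  have hb0 : 0 ≤ b := (secondMoment_isPositive h.covariate).inner_nonneg_right u
  have key : ∀ s : ℝ, 0 ≤ s ^ 2 * b / 2 - s * a := fun s => by
    have h1 := h.risk_sub wStar (s • u)
    simp_rw [map_smul, inner_smul_left, inner_smul_right, mul_left_comm _ s] at h1
    rw [integral_const_mul, ← ha, ← hb] at h1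
    simp only [conj_trivial] at h1
    linarith [hmin (wStar + s • u)]
  by_contra hne
  -- A near-minimizer of the quadratic in `s`; the `+ 1` avoids dividing by `b = 0`.
  have h1 := key (a / (b + 1))
  have h2 : (a / (b + 1)) ^ 2 * b / 2 - a / (b + 1) * a =
      -(a ^ 2 * (b + 2) / (2 * (b + 1) ^ 2)) := by field_simp; ring
  rw [h2] at h1
  have : 0 < a ^ 2 * (b + 2) / (2 * (b + 1) ^ 2) := by positivity
  linarith

lemma excessRisk_eq (h : FiniteSecondMoments D) (hmin : ∀ w, risk D wStar ≤ risk D w) (w : E) :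
    excessRisk D wStar w = (1 / 2) * ⟪w - wStar, secondMoment D (w - wStar)⟫ := by
  have := h.risk_sub wStar (w - wStar)
  rw [h.integral_residual_mul_eq_zero hmin, add_sub_cancel, sub_zero] at this
  exact this

/-- The new deviation from `wStar` after an SGD step from the deviation `e`. -/
def devStep (wStar : E) (r : ℝ) (e : E) (p : E × ℝ) : E :=
  e - (r * (⟪p.1, e⟫ - (p.2 - ⟪wStar, p.1⟫))) • p.1

lemma inner_devStep (A : E →L[ℝ] E) (hA : A.IsPositive) (r : ℝ) (e : E) (p : E × ℝ) :
    ⟪devStep wStar r e p, A (devStep wStar r e p)⟫ =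
      ⟪e, A e⟫ - 2 * r * (⟪p.1, e⟫ * ⟪p.1, A e⟫) +
        2 * r * ((p.2 - ⟪wStar, p.1⟫) * ⟪p.1, A e⟫) +
        r ^ 2 * ((⟪p.1, e⟫ - (p.2 - ⟪wStar, p.1⟫)) ^ 2 * ⟪p.1, A p.1⟫) := by
  have h1 : ⟪e, A p.1⟫ = ⟪p.1, A e⟫ := by
    rw [← hA.inner_left_eq_inner_right, real_inner_comm]
  simp only [devStep, map_sub, map_smul, inner_sub_left, inner_sub_right, inner_smul_left,
    inner_smul_right, h1, conj_trivial]
  ring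

lemma integrable_outer_comp (h : Integrable (fun p : E × ℝ => ‖p.1‖ ^ 4) D) (A : E →L[ℝ] E) :
    Integrable (fun p : E × ℝ => outer p.1 ∘L A ∘L outer p.1) D := by
  have hc : Continuous fun p : E × ℝ => outer p.1 := continuous_outer.comp continuous_fst
  refine (h.const_mul ‖A‖).mono'
    (hc.clm_comp (continuous_const.clm_comp hc)).aestronglyMeasurable (.of_forall fun p => ?_)
  have h1 := ContinuousLinearMap.opNorm_comp_le (outer p.1) (A ∘L outer p.1)
  have h2 := ContinuousLinearMap.opNorm_comp_le A (outer p.1)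
  rw [norm_outer] at h1 h2
  nlinarith [sq_nonneg ‖p.1‖]

lemma inner_fourthMoment (h : Integrable (fun p : E × ℝ => ‖p.1‖ ^ 4) D) (A : E →L[ℝ] E) (e : E) :
    ⟪e, fourthMoment D A e⟫ = ∫ p, ⟪p.1, e⟫ ^ 2 * ⟪p.1, A p.1⟫ ∂D := by
  rw [fourthMoment, integral_inner_apply (integrable_outer_comp h A)]
  refine integral_congr_ae (.of_forall fun p => ?_)
  simp only [ContinuousLinearMap.comp_apply, inner_outer]
  simp only [outer_apply, map_smul, inner_smul_right]
  ring

lemma integrable_inner_sq_mul (h : Integrable (fun p : E × ℝ => ‖p.1‖ ^ 4) D) (A : E →L[ℝ] E)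
    (e : E) : Integrable (fun p : E × ℝ => ⟪p.1, e⟫ ^ 2 * ⟪p.1, A p.1⟫) D := by
  refine (((integrable_outer_comp h A).apply_continuousLinearMap e).const_inner e).congr
    (.of_forall fun p => ?_)
  simp only [ContinuousLinearMap.comp_apply, inner_outer]
  simp only [outer_apply, map_smul, inner_smul_right]
  ring

lemma integrable_residual_sq_mul
    (h : Integrable (fun p : E × ℝ => (p.2 - ⟪wStar, p.1⟫) ^ 2 * ‖p.1‖ ^ 2) D) (A : E →L[ℝ] E) :
    Integrable (fun p : E × ℝ => (p.2 - ⟪wStar, p.1⟫) ^ 2 * ⟪p.1, A p.1⟫) D := by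
  refine (h.const_mul ‖A‖).mono' (by fun_prop) (.of_forall fun p => ?_)
  rw [norm_mul, Real.norm_of_nonneg (sq_nonneg _), Real.norm_eq_abs]
  calc _ ≤ (p.2 - ⟪wStar, p.1⟫) ^ 2 * (‖A‖ * (‖p.1‖ * ‖p.1‖)) := by
        gcongr; exact abs_inner_apply_le A p.1 p.1
    _ = _ := by ring

lemma integrable_step_sq_mul (h4 : Integrable (fun p : E × ℝ => ‖p.1‖ ^ 4) D)
    (h : Integrable (fun p : E × ℝ => (p.2 - ⟪wStar, p.1⟫) ^ 2 * ‖p.1‖ ^ 2) D) (A : E →L[ℝ] E)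
    (hA : A.IsPositive) (e : E) :
    Integrable (fun p : E × ℝ => (⟪p.1, e⟫ - (p.2 - ⟪wStar, p.1⟫)) ^ 2 * ⟪p.1, A p.1⟫) D := by
  refine (((integrable_inner_sq_mul h4 A e).const_mul 2).add
    ((integrable_residual_sq_mul h A).const_mul 2)).mono' (by fun_prop) (.of_forall fun p => ?_)
  have := hA.inner_nonneg_right p.1
  rw [Real.norm_of_nonneg (by positivity), Pi.add_apply]
  nlinarith [mul_nonneg (sq_nonneg (⟪p.1, e⟫ + (p.2 - ⟪wStar, p.1⟫))) this]

lemma integrable_inner_devStep [IsProbabilityMeasure D] (h2 : FiniteSecondMoments D)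
    (h4 : Integrable (fun p : E × ℝ => ‖p.1‖ ^ 4) D)
    (hn : Integrable (fun p : E × ℝ => (p.2 - ⟪wStar, p.1⟫) ^ 2 * ‖p.1‖ ^ 2) D)
    (A : E →L[ℝ] E) (hA : A.IsPositive) (r : ℝ) (e : E) :
    Integrable (fun p => ⟪devStep wStar r e p, A (devStep wStar r e p)⟫) D := by
  simp_rw [inner_devStep A hA]
  exact (((integrable_const _).sub
    ((integrable_inner_mul_inner h2.covariate e (A e)).const_mul _)).add
    ((h2.integrable_residual_mul wStar (A e)).const_mul _)).add
    ((integrable_step_sq_mul h4 hn A hA e).const_mul _)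

lemma integral_inner_devStep [IsProbabilityMeasure D] (h2 : FiniteSecondMoments D)
    (hmin : ∀ w, risk D wStar ≤ risk D w)
    (h4 : Integrable (fun p : E × ℝ => ‖p.1‖ ^ 4) D)
    (hn : Integrable (fun p : E × ℝ => (p.2 - ⟪wStar, p.1⟫) ^ 2 * ‖p.1‖ ^ 2) D)
    (A : E →L[ℝ] E) (hA : A.IsPositive) (r : ℝ) (e : E) :
    ∫ p, ⟪devStep wStar r e p, A (devStep wStar r e p)⟫ ∂D =
      ⟪e, A e⟫ - 2 * r * ⟪e, secondMoment D (A e)⟫ +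
        r ^ 2 * ∫ p, (⟪p.1, e⟫ - (p.2 - ⟪wStar, p.1⟫)) ^ 2 * ⟪p.1, A p.1⟫ ∂D := by
  have i1 : Integrable (fun _ : E × ℝ => ⟪e, A e⟫) D := integrable_const _
  have i2 := (integrable_inner_mul_inner h2.covariate e (A e)).const_mul (2 * r)
  have i3 := (h2.integrable_residual_mul wStar (A e)).const_mul (2 * r)
  have i4 := (integrable_step_sq_mul h4 hn A hA e).const_mul (r ^ 2)
  have i12 : Integrable (fun p : E × ℝ => ⟪e, A e⟫ - 2 * r * (⟪p.1, e⟫ * ⟪p.1, A e⟫)) D :=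
    i1.sub i2
  have i123 : Integrable (fun p : E × ℝ => ⟪e, A e⟫ - 2 * r * (⟪p.1, e⟫ * ⟪p.1, A e⟫) +
    2 * r * ((p.2 - ⟪wStar, p.1⟫) * ⟪p.1, A e⟫)) D := i12.add i3
  simp_rw [inner_devStep A hA]
  rw [integral_add i123 i4, integral_add i12 i3, integral_sub i1 i2, integral_const_mul,
    integral_const_mul, integral_const_mul, h2.integral_residual_mul_eq_zero hmin,
    inner_secondMoment h2.covariate]
  simp

/-- The operators `Qᵀ 𝔼[x xᵀ] Q`. -/
def IsConjMoment (A : E →L[ℝ] E) : Prop :=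
  ∃ (D : Measure (E × ℝ)) (Q : E →L[ℝ] E), IsProbabilityMeasure D ∧
    Integrable (fun p : E × ℝ => ‖p.1‖ ^ 2) D ∧ A = conj Q (secondMoment D)

lemma isConjMoment_secondMoment [IsProbabilityMeasure D]
    (h : Integrable (fun p : E × ℝ => ‖p.1‖ ^ 2) D) : IsConjMoment (secondMoment D) :=
  ⟨D, ContinuousLinearMap.id ℝ E, inferInstance, h,
    ContinuousLinearMap.ext fun u => ext_inner_left ℝ fun v => by simp [inner_conj]⟩

/-- Backward unrolling replaces `A` by its congruences, so the class of test operators must be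
stable under them. For this class the noise bound, an inequality between forms at single vectors,
can be integrated to bound `⟪x, A x⟫`. -/
lemma IsConjMoment.conj {A : E →L[ℝ] E} (hA : IsConjMoment A) (T : E →L[ℝ] E) :
    IsConjMoment (conj T A) := by
  obtain ⟨D, Q, hD, h, rfl⟩ := hA
  refine ⟨D, Q ∘L T, hD, h, ContinuousLinearMap.ext fun u => ext_inner_left ℝ fun v => ?_⟩
  simp [inner_conj]

lemma IsConjMoment.isPositive {A : E →L[ℝ] E} (hA : IsConjMoment A) : A.IsPositive := by
  obtain ⟨D, Q, hD, h, rfl⟩ := hA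
  exact conj_isPositive Q (secondMoment_isPositive h)

lemma NoiseBound.integral_inner_sq_le {σ : ℝ} (hn : NoiseBound D wStar σ) (u : E) :
    ∫ p, (p.2 - ⟪wStar, p.1⟫) ^ 2 * ⟪p.1, u⟫ ^ 2 ∂D ≤ σ ^ 2 * ⟪u, secondMoment D u⟫ := by
  have h1 := inner_apply_le_of_le hn.bound u
  have hi : Integrable (fun p : E × ℝ => (p.2 - ⟪wStar, p.1⟫) ^ 2 • outer p.1) D :=
    hn.integrable.mono
      (Continuous.aestronglyMeasurable (by
        have hc : Continuous fun p : E × ℝ => outer p.1 := continuous_outer.comp continuous_fst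
        fun_prop))
      (.of_forall fun p => by simp [norm_smul, norm_outer])
  rw [integral_inner_apply hi, smul_apply, inner_smul_right] at h1
  refine le_trans (le_of_eq (integral_congr_ae (.of_forall fun p => ?_))) h1
  simp only [smul_apply, inner_smul_right, inner_outer]
  ring

/-- Noise bound against a general quadratic form. -/
lemma NoiseBound.integral_inner_apply_le [IsProbabilityMeasure D] {σ : ℝ}
    (h2 : Integrable (fun p : E × ℝ => ‖p.1‖ ^ 2) D)
    (hn : NoiseBound D wStar σ) {A : E →L[ℝ] E} (hA : IsConjMoment A) :
    ∫ p, (p.2 - ⟪wStar, p.1⟫) ^ 2 * ⟪p.1, A p.1⟫ ∂D ≤ σ ^ 2 * ∫ p, ⟪p.1, A p.1⟫ ∂D := by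
  obtain ⟨D', Q, hD', h, rfl⟩ := hA
  set B := ContinuousLinearMap.adjoint Q
  -- The form is an average of squares of linear forms; after Fubini the noise bound applies at each
  -- vector `B z.1`.
  have hform : ∀ x : E, ⟪x, CovShift.conj Q (secondMoment D') x⟫ = ∫ z, ⟪x, B z.1⟫ ^ 2 ∂D' := by
    intro x
    rw [inner_conj, inner_secondMoment h]
    refine integral_congr_ae (.of_forall fun z => ?_)
    simp only [B]
    rw [ContinuousLinearMap.adjoint_inner_right, real_inner_comm, sq]
  have hint : ∀ f : E × ℝ → ℝ, Continuous f → Integrable (fun p => f p ^ 2 * ‖p.1‖ ^ 2) D →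
      Integrable (fun w : (E × ℝ) × (E × ℝ) => f w.1 ^ 2 * ⟪w.1.1, B w.2.1⟫ ^ 2)
        (D.prod D') := by
    intro f hf hfi
    refine ((hfi.mul_prod h).const_mul (‖B‖ ^ 2)).mono' (by fun_prop) (.of_forall fun w => ?_)
    rw [Real.norm_of_nonneg (by positivity)]
    have := pow_le_pow_left₀ (abs_nonneg _) (abs_inner_apply_le B w.1.1 w.2.1) 2
    rw [sq_abs] at this
    nlinarith [sq_nonneg (f w.1)]
  have h1 := hint (fun p => p.2 - ⟪wStar, p.1⟫) (by fun_prop) hn.integrable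
  have h3 := hint (fun _ => 1) (by fun_prop) (by simpa using h2)
  simp only [one_pow, one_mul] at h3
  simp_rw [hform, ← integral_const_mul]
  rw [integral_integral_swap h1]
  conv_rhs => rw [integral_integral_swap (h3.const_mul (σ ^ 2))]
  refine integral_mono h1.integral_prod_right (h3.const_mul (σ ^ 2)).integral_prod_right
    fun z => ?_
  simp only [integral_const_mul]
  have := hn.integral_inner_sq_le (B z.1)
  rw [inner_secondMoment h2] at this
  simpa only [sq] using this

lemma inner_sub_smul_secondMoment (h2 : Integrable (fun p : E × ℝ => ‖p.1‖ ^ 2) D)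
    {A : E →L[ℝ] E} (hA : A.IsPositive) (r : ℝ) (e : E) :
    ⟪e, conj (ContinuousLinearMap.id ℝ E - r • secondMoment D) A e⟫ =
      ⟪e, A e⟫ - 2 * r * ⟪e, secondMoment D (A e)⟫ +
        r ^ 2 * ⟪e, secondMoment D (A (secondMoment D e))⟫ := by
  have hG := secondMoment_isPositive h2
  have h1 : ⟪secondMoment D e, A e⟫ = ⟪e, secondMoment D (A e)⟫ :=
    hG.inner_left_eq_inner_right _ _
  have h3 : ⟪e, A (secondMoment D e)⟫ = ⟪e, secondMoment D (A e)⟫ := by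
    rw [← hA.inner_left_eq_inner_right, real_inner_comm, h1]
  have h4 : ⟪secondMoment D e, A (secondMoment D e)⟫ =
      ⟪e, secondMoment D (A (secondMoment D e))⟫ := hG.inner_left_eq_inner_right _ _
  simp only [inner_conj, sub_apply, smul_apply,
    ContinuousLinearMap.id_apply, map_sub, map_smul, inner_sub_left, inner_sub_right,
    inner_smul_left, inner_smul_right, conj_trivial, h1, h3, h4]
  ring

/-- Upper bound for the expected energy after one SGD step. -/
lemma integral_inner_devStep_le [IsProbabilityMeasure D] {α σ : ℝ} (h2 : FiniteSecondMoments D)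
    (hmin : ∀ w, risk D wStar ≤ risk D w) (h4 : FourthMomentUpper D α)
    (hn : NoiseBound D wStar σ) {A : E →L[ℝ] E} (hA : IsConjMoment A) (r : ℝ) (e : E) :
    ∫ p, ⟪devStep wStar r e p, A (devStep wStar r e p)⟫ ∂D ≤
      ⟪e, conj (ContinuousLinearMap.id ℝ E - r • secondMoment D) A e⟫ +
        2 * r ^ 2 * (∫ p, ⟪p.1, A p.1⟫ ∂D) * (α * ⟪e, secondMoment D e⟫ + σ ^ 2) := by
  have hAp := hA.isPositive
  have i1 := integrable_inner_sq_mul h4.integrable A e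
  have i2 := integrable_residual_sq_mul hn.integrable A
  rw [integral_inner_devStep h2 hmin h4.integrable hn.integrable A hAp,
    inner_sub_smul_secondMoment h2.covariate hAp]
  have b1 := inner_apply_le_of_le (h4.bound A hAp) e
  rw [inner_fourthMoment h4.integrable, trace_secondMoment_comp h2.covariate,
    smul_apply, inner_smul_right] at b1
  have b2 := hn.integral_inner_apply_le h2.covariate hA
  -- Residual and covariate may be dependent, so the cross term is removed by `(a - b)² ≤ 2a² +
  -- 2b²`; this is the factor 2 in the upper recursion.
  have b3 : ∫ p, (⟪p.1, e⟫ - (p.2 - ⟪wStar, p.1⟫)) ^ 2 * ⟪p.1, A p.1⟫ ∂D ≤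
      2 * ∫ p, ⟪p.1, e⟫ ^ 2 * ⟪p.1, A p.1⟫ ∂D +
        2 * ∫ p, (p.2 - ⟪wStar, p.1⟫) ^ 2 * ⟪p.1, A p.1⟫ ∂D := by
    rw [← integral_const_mul, ← integral_const_mul, ← integral_add (i1.const_mul 2)
      (i2.const_mul 2)]
    refine integral_mono (integrable_step_sq_mul h4.integrable hn.integrable A hAp e)
      ((i1.const_mul 2).add (i2.const_mul 2)) fun p => ?_
    have := hAp.inner_nonneg_right p.1
    simp only
    nlinarith [mul_nonneg (sq_nonneg (⟪p.1, e⟫ + (p.2 - ⟪wStar, p.1⟫))) this]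
  have b4 : 0 ≤ ⟪e, secondMoment D (A (secondMoment D e))⟫ := by
    rw [← (secondMoment_isPositive h2.covariate).inner_left_eq_inner_right]
    exact hAp.inner_nonneg_right _
  nlinarith [sq_nonneg r, mul_nonneg (sq_nonneg r) b4,
    mul_le_mul_of_nonneg_left (b3.trans (add_le_add (mul_le_mul_of_nonneg_left b1 two_pos.le)
      (mul_le_mul_of_nonneg_left b2 two_pos.le))) (sq_nonneg r)]

lemma WellSpecified.integral_residual_sq {σ : ℝ} (hw : WellSpecified D wStar σ) :
    ∫ p, (p.2 - ⟪wStar, p.1⟫) ^ 2 ∂D = σ ^ 2 := by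
  have h0 : ∫ x, x ∂(gaussianReal 0 (σ ^ 2).toNNReal) = 0 := integral_id_gaussianReal
  have h1 := variance_fun_id_gaussianReal (μ := 0) (v := (σ ^ 2).toNNReal)
  rw [variance_of_integral_eq_zero (by fun_prop) h0, Real.coe_toNNReal _ (sq_nonneg σ)] at h1
  rw [← h1, ← hw.gaussian.map_eq,
    integral_map hw.gaussian.aemeasurable (Continuous.aestronglyMeasurable (by fun_prop))]

/-- Lower bound for the expected energy after one SGD step. -/
lemma le_integral_inner_devStep [IsProbabilityMeasure D] {β σ : ℝ} (h2 : FiniteSecondMoments D)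
    (hmin : ∀ w, risk D wStar ≤ risk D w) (h4 : FourthMomentLower D β)
    (hn : Integrable (fun p : E × ℝ => (p.2 - ⟪wStar, p.1⟫) ^ 2 * ‖p.1‖ ^ 2) D)
    (hw : WellSpecified D wStar σ) {A : E →L[ℝ] E} (hA : A.IsPositive) (r : ℝ) (e : E) :
    ⟪e, conj (ContinuousLinearMap.id ℝ E - r • secondMoment D) A e⟫ +
        r ^ 2 * (∫ p, ⟪p.1, A p.1⟫ ∂D) * (β * ⟪e, secondMoment D e⟫ + σ ^ 2) ≤
      ∫ p, ⟪devStep wStar r e p, A (devStep wStar r e p)⟫ ∂D := by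
  have i1 := integrable_inner_sq_mul h4.integrable A e
  have i2 := integrable_residual_sq_mul hn A
  have i3 := integrable_step_sq_mul h4.integrable hn A hA e
  rw [integral_inner_devStep h2 hmin h4.integrable hn A hA,
    inner_sub_smul_secondMoment h2.covariate hA]
  have b1 := inner_apply_le_of_le (h4.bound A hA) e
  rw [sub_apply, inner_sub_right,
    inner_fourthMoment h4.integrable, trace_secondMoment_comp h2.covariate,
    smul_apply, inner_smul_right] at b1
  simp only [ContinuousLinearMap.comp_apply] at b1
  have hmean : ∫ p, (p.2 - ⟪wStar, p.1⟫) ∂D = 0 := by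
    have := hw.gaussian.integral_eq
    rw [this, integral_id_gaussianReal]
  have b2 : ∫ p, (p.2 - ⟪wStar, p.1⟫) ^ 2 * ⟪p.1, A p.1⟫ ∂D =
      σ ^ 2 * ∫ p, ⟪p.1, A p.1⟫ ∂D := by
    have hind : IndepFun (fun p : E × ℝ => (p.2 - ⟪wStar, p.1⟫) ^ 2)
        (fun p : E × ℝ => ⟪p.1, A p.1⟫) D :=
      hw.indep.symm.comp (φ := fun s => s ^ 2) (ψ := fun x => ⟪x, A x⟫)
        (by fun_prop) (Continuous.measurable (by fun_prop))
    rw [← hw.integral_residual_sq]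
    exact hind.integral_fun_mul_eq_mul_integral (Continuous.aestronglyMeasurable (by fun_prop))
      (Continuous.aestronglyMeasurable (by fun_prop))
  have b5 : ∫ p, (p.2 - ⟪wStar, p.1⟫) * (⟪p.1, e⟫ * ⟪p.1, A p.1⟫) ∂D = 0 := by
    have hind : IndepFun (fun p : E × ℝ => p.2 - ⟪wStar, p.1⟫)
        (fun p : E × ℝ => ⟪p.1, e⟫ * ⟪p.1, A p.1⟫) D :=
      hw.indep.symm.comp (φ := fun s => s) (ψ := fun x => ⟪x, e⟫ * ⟪x, A x⟫)
        measurable_id (Continuous.measurable (by fun_prop))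
    rw [hind.integral_fun_mul_eq_mul_integral (Continuous.aestronglyMeasurable (by fun_prop))
      (Continuous.aestronglyMeasurable (by fun_prop)), hmean, zero_mul]
  -- By polarization the cross term is half of a combination of three integrable functions.
  have i5 : Integrable (fun p : E × ℝ =>
      (p.2 - ⟪wStar, p.1⟫) * (⟪p.1, e⟫ * ⟪p.1, A p.1⟫)) D := by
    refine (((i1.add i2).sub i3).const_mul (1 / 2)).congr (.of_forall fun p => ?_)
    simp only [Pi.add_apply, Pi.sub_apply]; ring
  have b3 : ∫ p, (⟪p.1, e⟫ - (p.2 - ⟪wStar, p.1⟫)) ^ 2 * ⟪p.1, A p.1⟫ ∂D =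
      ∫ p, ⟪p.1, e⟫ ^ 2 * ⟪p.1, A p.1⟫ ∂D +
        ∫ p, (p.2 - ⟪wStar, p.1⟫) ^ 2 * ⟪p.1, A p.1⟫ ∂D := by
    have hpt : ∀ p : E × ℝ, (⟪p.1, e⟫ - (p.2 - ⟪wStar, p.1⟫)) ^ 2 * ⟪p.1, A p.1⟫ =
        ⟪p.1, e⟫ ^ 2 * ⟪p.1, A p.1⟫ + (p.2 - ⟪wStar, p.1⟫) ^ 2 * ⟪p.1, A p.1⟫ -
          2 * ((p.2 - ⟪wStar, p.1⟫) * (⟪p.1, e⟫ * ⟪p.1, A p.1⟫)) := fun p => by ring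
    have i12 : Integrable (fun p : E × ℝ => ⟪p.1, e⟫ ^ 2 * ⟪p.1, A p.1⟫ +
      (p.2 - ⟪wStar, p.1⟫) ^ 2 * ⟪p.1, A p.1⟫) D := i1.add i2
    simp_rw [hpt]
    rw [integral_sub i12 (i5.const_mul 2), integral_add i1 i2, integral_const_mul, b5]
    ring
  rw [b3, b2]
  -- The `G A G` in the lower moment condition is exactly the quadratic term of the congruence by `I
  -- - r G`.
  nlinarith [mul_le_mul_of_nonneg_left b1 (sq_nonneg r)]

/-- The fourth moment constant is at least `1`. -/
lemma FourthMomentUpper.one_le [IsProbabilityMeasure D] {α : ℝ} (h2 : FiniteSecondMoments D)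
    (h4 : FourthMomentUpper D α) {u : E} (hu : 0 < ⟪u, secondMoment D u⟫) : 1 ≤ α := by
  set s := ⟪u, secondMoment D u⟫ with hs
  have hs' : s = ∫ p, ⟪p.1, u⟫ ^ 2 ∂D := by
    rw [hs, inner_secondMoment h2.covariate]; simp_rw [sq]
  have b1 := inner_apply_le_of_le (h4.bound (outer u)
    (InnerProductSpace.isPositive_rankOne_self u)) u
  rw [inner_fourthMoment h4.integrable, trace_secondMoment_comp h2.covariate,
    smul_apply, inner_smul_right] at b1
  have i4 := integrable_inner_sq_mul h4.integrable (outer u) u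
  have hpt : ∀ x : E, ⟪x, outer u x⟫ = ⟪x, u⟫ ^ 2 := fun x => by
    rw [inner_outer, real_inner_comm x u, sq]
  simp_rw [hpt] at b1 i4
  rw [← hs', ← hs] at b1
  have i2 : Integrable (fun p : E × ℝ => ⟪p.1, u⟫ ^ 2) D := by
    simpa only [sq] using integrable_inner_mul_inner h2.covariate u u
  -- Jensen for `⟪x, u⟫²`, whose mean is `s`: the fourth moment is at least `s²`, while the
  -- hypothesis bounds it by `α s²`.
  have key : 2 * s * s - s ^ 2 ≤ ∫ p, ⟪p.1, u⟫ ^ 2 * ⟪p.1, u⟫ ^ 2 ∂D := by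
    have : ∫ p, (2 * s * ⟪p.1, u⟫ ^ 2 - s ^ 2) ∂D = 2 * s * s - s ^ 2 := by
      rw [integral_sub (i2.const_mul _) (integrable_const _), integral_const_mul, ← hs']; simp
    rw [← this]
    refine integral_mono ((i2.const_mul _).sub (integrable_const _)) i4 fun p => ?_
    simp only
    nlinarith [sq_nonneg (⟪p.1, u⟫ ^ 2 - s)]
  by_contra hα
  nlinarith [mul_pos hu hu]

end OneStep

/-! ### Measurability and independence of the iterates; the energy recursion. -/

section Iterates

variable {E : Type*} [NormedAddCommGroup E] [InnerProductSpace ℝ E]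

lemma sgd_sub_succ (η : ℕ → ℝ) (w₀ wStar : E) (z : ℕ → E × ℝ) (t : ℕ) :
    sgd η w₀ z (t + 1) - wStar = devStep wStar (η t) (sgd η w₀ z t - wStar) (z t) := by
  have h : ⟪(z t).1, sgd η w₀ z t⟫ =
      ⟪(z t).1, sgd η w₀ z t - wStar⟫ + ⟪wStar, (z t).1⟫ := by
    rw [inner_sub_right, real_inner_comm wStar]; ring
  rw [sgd, devStep, outer_apply, h]
  module

lemma sgd_congr (η : ℕ → ℝ) (w₀ : E) {z z' : ℕ → E × ℝ} (t : ℕ) (h : ∀ s < t, z s = z' s) :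
    sgd η w₀ z t = sgd η w₀ z' t := by
  induction t with
  | zero => rfl
  | succ t ih => rw [sgd, sgd, ih fun s hs => h s (hs.trans t.lt_succ_self), h t t.lt_succ_self]

variable [CompleteSpace E] [SecondCountableTopology E] [MeasurableSpace E] [BorelSpace E]

lemma continuous_devStep (wStar : E) (r : ℝ) :
    Continuous fun q : E × (E × ℝ) => devStep wStar r q.1 q.2 := by
  unfold devStep; fun_prop

lemma measurable_sgd (η : ℕ → ℝ) (w₀ : E) {X : Type*} [MeasurableSpace X] {z : X → ℕ → E × ℝ}
    (hz : ∀ t, Measurable fun x => z x t) (t : ℕ) : Measurable fun x => sgd η w₀ (z x) t := by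
  induction t with
  | zero => exact measurable_const
  | succ t ih =>
    have h : (fun x => sgd η w₀ (z x) (t + 1)) =
        (fun q : E × (E × ℝ) => devStep 0 (η t) q.1 q.2) ∘
          fun x => (sgd η w₀ (z x) t, z x t) := by
      funext x; simpa using sgd_sub_succ η w₀ 0 (z x) t
    rw [h]
    exact (continuous_devStep 0 (η t)).measurable.comp (ih.prodMk (hz t))

variable {D : Measure (E × ℝ)} {Ω : Type*} [MeasurableSpace Ω] {P : Measure Ω}
  {Z : ℕ → Ω → E × ℝ} {M : ℕ}

/-- Up to time `M` the iterate is a measurable function of the samples used so far. -/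
lemma exists_measurable_sgd_eq (η : ℕ → ℝ) (w₀ : E) (S : Finset (Fin M)) {t : ℕ}
    (hS : ∀ s : Fin M, (s : ℕ) < t → s ∈ S) (htM : t ≤ M) :
    ∃ g : (S → E × ℝ) → E, Measurable g ∧
      ∀ z : ℕ → E × ℝ, sgd η w₀ z t = g fun s => z s.1 := by
  classical
  -- Samples outside `S` are set to `0`; the iterate at time `t` never reads them.
  refine ⟨fun y => sgd η w₀ (fun k => if h : ∃ hk : k < M, (⟨k, hk⟩ : Fin M) ∈ S then
    y ⟨⟨k, h.1⟩, h.2⟩ else 0) t, measurable_sgd η w₀ (fun k => ?_) t, fun z => ?_⟩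
  · by_cases h : ∃ hk : k < M, (⟨k, hk⟩ : Fin M) ∈ S
    · simp only [h, dite_true]; exact measurable_pi_apply _
    · simp only [h, dite_false]; exact measurable_const
  · refine sgd_congr η w₀ t fun s hs => ?_
    have h : ∃ hk : s < M, (⟨s, hk⟩ : Fin M) ∈ S := ⟨hs.trans_le htM, hS _ hs⟩
    simp only [h, dite_true]

lemma aemeasurable_sgd (hZ : ∀ t < M, HasLaw (Z t) D P) (η : ℕ → ℝ) (w₀ : E) {t : ℕ}
    (ht : t ≤ M) : AEMeasurable (fun ω => sgd η w₀ (fun k => Z k ω) t) P := by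
  obtain ⟨g, hg, h⟩ := exists_measurable_sgd_eq (M := M) η w₀ Finset.univ
    (fun _ _ => Finset.mem_univ _) ht
  simp_rw [h]
  exact hg.comp_aemeasurable (aemeasurable_pi_lambda _ fun s => (hZ _ s.1.2).aemeasurable)

lemma indepFun_sgd (hZ : ∀ t < M, HasLaw (Z t) D P) (hi : iIndepFun (fun t : Fin M => Z t) P)
    (η : ℕ → ℝ) (w₀ : E) {t : ℕ} (ht : t < M) :
    IndepFun (fun ω => sgd η w₀ (fun k => Z k ω) t) (Z t) P := by
  classical
  set S : Finset (Fin M) := Finset.univ.filter fun s => (s : ℕ) < t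
  obtain ⟨g, hg, h⟩ := exists_measurable_sgd_eq (M := M) η w₀ S (t := t)
    (fun s hs => by simpa [S] using hs) ht.le
  have hdisj : Disjoint S {⟨t, ht⟩} := by simp [S]
  have := (hi.indepFun_finset₀ S {⟨t, ht⟩} hdisj fun s => (hZ _ s.2).aemeasurable).comp hg
    (measurable_pi_apply (⟨⟨t, ht⟩, Finset.mem_singleton_self _⟩ :
      ({⟨t, ht⟩} : Finset (Fin M))))
  simp_rw [h]
  exact this

/-- The second moment `𝔼⟪w_t - wStar, A (w_t - wStar)⟫` of the SGD iterate. -/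
def energy (P : Measure Ω) (Z : ℕ → Ω → E × ℝ) (η : ℕ → ℝ) (w₀ wStar : E) (t : ℕ)
    (A : E →L[ℝ] E) : ℝ≥0∞ :=
  ∫⁻ ω, ENNReal.ofReal (sqNorm A (sgd η w₀ (fun k => Z k ω) t - wStar)) ∂P

lemma continuous_sqNorm (A : E →L[ℝ] E) : Continuous (sqNorm A) := by
  unfold sqNorm; fun_prop

lemma isProbabilityMeasure_of_hasLaw [IsProbabilityMeasure D] (hM : 0 < M)
    (hZ : ∀ t < M, HasLaw (Z t) D P) : IsProbabilityMeasure P :=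
  (hZ 0 hM).isProbabilityMeasure

lemma energy_zero [IsProbabilityMeasure P] (η : ℕ → ℝ) (w₀ wStar : E) (A : E →L[ℝ] E) :
    energy P Z η w₀ wStar 0 A = ENNReal.ofReal (sqNorm A (w₀ - wStar)) := by
  simp [energy, sgd]

variable {wStar : E}

/-- The current iterate is independent of the fresh sample, so the joint law is a product and
Tonelli applies. No integrability of the iterate is needed. -/
lemma energy_succ [IsProbabilityMeasure D] [IsProbabilityMeasure P]
    (hZ : ∀ t < M, HasLaw (Z t) D P)
    (hi : iIndepFun (fun t : Fin M => Z t) P) (h2 : FiniteSecondMoments D)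
    (h4 : Integrable (fun p : E × ℝ => ‖p.1‖ ^ 4) D)
    (hn : Integrable (fun p : E × ℝ => (p.2 - ⟪wStar, p.1⟫) ^ 2 * ‖p.1‖ ^ 2) D)
    {A : E →L[ℝ] E} (hA : A.IsPositive) (η : ℕ → ℝ) (w₀ : E) {t : ℕ} (ht : t < M) :
    energy P Z η w₀ wStar (t + 1) A = ∫⁻ ω, ENNReal.ofReal (∫ p,
      sqNorm A (devStep wStar (η t) (sgd η w₀ (fun k => Z k ω) t - wStar) p) ∂D) ∂P := by
  have hW := aemeasurable_sgd hZ η w₀ ht.le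
  have hZt := (hZ t ht).aemeasurable
  have hprod := (indepFun_iff_map_prod_eq_prod_map_map hW hZt).1 (indepFun_sgd hZ hi η w₀ ht)
  rw [(hZ t ht).map_eq] at hprod
  set F : E × (E × ℝ) → ℝ≥0∞ := fun q =>
    ENNReal.ofReal (sqNorm A (devStep wStar (η t) (q.1 - wStar) q.2)) with hF
  have hFm : Measurable F := by
    refine ENNReal.measurable_ofReal.comp (Continuous.measurable ?_)
    exact (continuous_sqNorm A).comp ((continuous_devStep wStar (η t)).comp
      ((continuous_fst.sub continuous_const).prodMk continuous_snd))
  have hmap : AEMeasurable (fun q => ∫⁻ p, F (q, p) ∂D)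
      (P.map fun ω => sgd η w₀ (fun k => Z k ω) t) :=
    hFm.lintegral_prod_right'.aemeasurable
  calc energy P Z η w₀ wStar (t + 1) A
      = ∫⁻ ω, F (sgd η w₀ (fun k => Z k ω) t, Z t ω) ∂P := by
        simp only [energy, hF, sgd_sub_succ]
    _ = ∫⁻ q, F q ∂(P.map fun ω => (sgd η w₀ (fun k => Z k ω) t, Z t ω)) :=
        (lintegral_map' hFm.aemeasurable (hW.prodMk hZt)).symm
    _ = ∫⁻ w, ∫⁻ p, F (w, p) ∂D ∂(P.map fun ω => sgd η w₀ (fun k => Z k ω) t) := by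
        rw [hprod, lintegral_prod _ hFm.aemeasurable]
    _ = ∫⁻ ω, ∫⁻ p, F (sgd η w₀ (fun k => Z k ω) t, p) ∂D ∂P := lintegral_map' hmap hW
    _ = _ := by
        refine lintegral_congr fun ω => ?_
        rw [ofReal_integral_eq_lintegral_ofReal]
        · exact integrable_inner_devStep h2 h4 hn A hA _ _
        · exact .of_forall fun p => hA.inner_nonneg_right _

lemma lintegral_ofReal_add_mul {f g : Ω → ℝ} {a b c : ℝ} [IsProbabilityMeasure P]
    (hf : ∀ ω, 0 ≤ f ω) (hg : ∀ ω, 0 ≤ g ω)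
    (hfm : AEMeasurable f P) (ha : 0 ≤ a) (hb : 0 ≤ b) (hc : 0 ≤ c) :
    ∫⁻ ω, ENNReal.ofReal (f ω + a * (b * g ω + c)) ∂P =
      ∫⁻ ω, ENNReal.ofReal (f ω) ∂P + ENNReal.ofReal a *
        (ENNReal.ofReal b * ∫⁻ ω, ENNReal.ofReal (g ω) ∂P + ENNReal.ofReal c) := by
  have h : ∀ ω, ENNReal.ofReal (f ω + a * (b * g ω + c)) = ENNReal.ofReal (f ω) +
      ENNReal.ofReal a * (ENNReal.ofReal b * ENNReal.ofReal (g ω) + ENNReal.ofReal c) := fun ω => by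
    have := hg ω
    rw [ENNReal.ofReal_add (hf ω) (by positivity), ENNReal.ofReal_mul ha,
      ENNReal.ofReal_add (by positivity) hc, ENNReal.ofReal_mul hb]
  simp_rw [h]
  rw [lintegral_add_left' hfm.ennreal_ofReal, lintegral_const_mul' _ _ ENNReal.ofReal_ne_top,
    lintegral_add_right' _ aemeasurable_const, lintegral_const_mul' _ _ ENNReal.ofReal_ne_top]
  simp

section Recursion

variable {α β σ : ℝ}

lemma aemeasurable_sqNorm_sgd (hZ : ∀ t < M, HasLaw (Z t) D P) (η : ℕ → ℝ) (w₀ : E) {t : ℕ}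
    (ht : t ≤ M) (A : E →L[ℝ] E) :
    AEMeasurable (fun ω => sqNorm A (sgd η w₀ (fun k => Z k ω) t - wStar)) P :=
  ((continuous_sqNorm A).comp (continuous_id.sub continuous_const)).measurable.comp_aemeasurable
    (aemeasurable_sgd hZ η w₀ ht)

lemma energy_succ_le [IsProbabilityMeasure D] [IsProbabilityMeasure P]
    (hZ : ∀ t < M, HasLaw (Z t) D P)
    (hi : iIndepFun (fun t : Fin M => Z t) P) (h2 : FiniteSecondMoments D)
    (hmin : ∀ w, risk D wStar ≤ risk D w) (h4 : FourthMomentUpper D α) (hα : 0 ≤ α)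
    (hn : NoiseBound D wStar σ) {A : E →L[ℝ] E} (hA : IsConjMoment A) (η : ℕ → ℝ) (w₀ : E) {t : ℕ}
    (ht : t < M) :
    energy P Z η w₀ wStar (t + 1) A ≤
      energy P Z η w₀ wStar t (conj (ContinuousLinearMap.id ℝ E - η t • secondMoment D) A) +
        ENNReal.ofReal (2 * η t ^ 2 * ∫ p, ⟪p.1, A p.1⟫ ∂D) *
          (ENNReal.ofReal α * energy P Z η w₀ wStar t (secondMoment D) +
            ENNReal.ofReal (σ ^ 2)) := by
  have hT : 0 ≤ ∫ p, ⟪p.1, A p.1⟫ ∂D := integral_nonneg fun p =>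
    hA.isPositive.inner_nonneg_right p.1
  rw [energy_succ hZ hi h2 h4.integrable hn.integrable hA.isPositive η w₀ ht]
  unfold energy
  rw [← lintegral_ofReal_add_mul (fun ω => sqNorm_nonneg (conj_isPositive _ hA.isPositive) _)
    (fun ω => sqNorm_nonneg (secondMoment_isPositive h2.covariate) _)
    (aemeasurable_sqNorm_sgd hZ η w₀ ht.le _)
    (by positivity) hα (sq_nonneg σ)]
  exact lintegral_mono fun ω => ENNReal.ofReal_le_ofReal
    (integral_inner_devStep_le h2 hmin h4 hn hA _ _)

lemma le_energy_succ [IsProbabilityMeasure D] [IsProbabilityMeasure P]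
    (hZ : ∀ t < M, HasLaw (Z t) D P)
    (hi : iIndepFun (fun t : Fin M => Z t) P) (h2 : FiniteSecondMoments D)
    (hmin : ∀ w, risk D wStar ≤ risk D w) (h4 : FourthMomentLower D β) (hβ : 0 ≤ β)
    (hn : NoiseBound D wStar σ) (hw : WellSpecified D wStar σ)
    {A : E →L[ℝ] E} (hA : A.IsPositive) (η : ℕ → ℝ) (w₀ : E) {t : ℕ} (ht : t < M) :
    energy P Z η w₀ wStar t (conj (ContinuousLinearMap.id ℝ E - η t • secondMoment D) A) +
        ENNReal.ofReal (η t ^ 2 * ∫ p, ⟪p.1, A p.1⟫ ∂D) *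
          (ENNReal.ofReal β * energy P Z η w₀ wStar t (secondMoment D) +
            ENNReal.ofReal (σ ^ 2)) ≤ energy P Z η w₀ wStar (t + 1) A := by
  have hT : 0 ≤ ∫ p, ⟪p.1, A p.1⟫ ∂D := integral_nonneg fun p => hA.inner_nonneg_right p.1
  rw [energy_succ hZ hi h2 h4.integrable hn.integrable hA η w₀ ht]
  unfold energy
  rw [← lintegral_ofReal_add_mul (fun ω => sqNorm_nonneg (conj_isPositive _ hA) _)
    (fun ω => sqNorm_nonneg (secondMoment_isPositive h2.covariate) _)
    (aemeasurable_sqNorm_sgd hZ η w₀ ht.le _)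
    (by positivity) hβ (sq_nonneg σ)]
  exact lintegral_mono fun ω => ENNReal.ofReal_le_ofReal
    (le_integral_inner_devStep h2 hmin h4 hn.integrable hw hA _ _)

/-- The induction runs over all test operators at once: one step back involves both the congruence
of `A` and the operator `G`. -/
lemma energy_ne_top [IsProbabilityMeasure D] [IsProbabilityMeasure P]
    (hZ : ∀ t < M, HasLaw (Z t) D P)
    (hi : iIndepFun (fun t : Fin M => Z t) P) (h2 : FiniteSecondMoments D)
    (hmin : ∀ w, risk D wStar ≤ risk D w) (h4 : FourthMomentUpper D α) (hα : 0 ≤ α)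
    (hn : NoiseBound D wStar σ) (η : ℕ → ℝ) (w₀ : E) {t : ℕ} (ht : t ≤ M) {A : E →L[ℝ] E}
    (hA : IsConjMoment A) : energy P Z η w₀ wStar t A ≠ ∞ := by
  induction t generalizing A with
  | zero => rw [energy_zero]; exact ENNReal.ofReal_ne_top
  | succ t ih =>
    refine ne_top_of_le_ne_top ?_ (energy_succ_le hZ hi h2 hmin h4 hα hn hA η w₀ ht)
    have h1 := ih (Nat.le_of_lt ht)
      (hA.conj (ContinuousLinearMap.id ℝ E - η t • secondMoment D))
    have h3 := ih (Nat.le_of_lt ht) (isConjMoment_secondMoment h2.covariate)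
    finiteness

end Recursion

end Iterates

/-! ### Closed form of the energy recursion. -/

section Unrolling

variable {E : Type*} [NormedAddCommGroup E] [InnerProductSpace ℝ E] [CompleteSpace E]
  {ι : Type*}

lemma contraction_succ (η : ℕ → ℝ) (G : E →L[ℝ] E) (t : ℕ) :
    contraction η G (t + 1) = contraction η G t * (ContinuousLinearMap.id ℝ E - η t • G) := by
  simp [contraction, List.range_succ]

lemma commute_contraction (η : ℕ → ℝ) (G : E →L[ℝ] E) (r : ℝ) (t : ℕ) :
    Commute (ContinuousLinearMap.id ℝ E - r • G) (contraction η G t) := by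
  refine Commute.list_prod_right _ _ fun x hx => ?_
  obtain ⟨s, -, rfl⟩ := List.mem_map.1 hx
  change Commute (1 - r • G) (1 - η s • G)
  exact ((Commute.one_left _).sub_left ((Commute.one_right _).sub_right
    (((Commute.refl G).smul_right _).smul_left _)))

lemma contraction_succ_apply (η : ℕ → ℝ) (G : E →L[ℝ] E) (t : ℕ) (u : E) :
    contraction η G (t + 1) u =
      (ContinuousLinearMap.id ℝ E - η t • G) (contraction η G t u) := by
  rw [contraction_succ, ← (commute_contraction η G (η t) t).eq]; rfl

variable {v : HilbertBasis ι ℝ E} {μ : ι → ℝ} {G : E →L[ℝ] E}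

lemma inner_contraction (hG : G.IsPositive) (hv : ∀ j, G (v j) = μ j • v j) (η : ℕ → ℝ) (t : ℕ)
    (u : E) (j : ι) : ⟪v j, contraction η G t u⟫ = decay η (μ j) 0 t * ⟪v j, u⟫ := by
  induction t with
  | zero => simp [contraction, decay]
  | succ t ih =>
    rw [contraction_succ_apply, decay_succ _ _ (Nat.zero_le t), sub_apply, inner_sub_right,
      smul_apply, inner_smul_right, ← hG.inner_left_eq_inner_right, hv, inner_smul_left,
      ContinuousLinearMap.id_apply, ih]
    simp only [conj_trivial]; ring

lemma hasSum_sqNorm (hG : G.IsPositive) (hv : ∀ j, G (v j) = μ j • v j) (u : E) :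
    HasSum (fun j => μ j * ⟪v j, u⟫ ^ 2) (sqNorm G u) := by
  have := v.hasSum_inner_mul_inner u (G u)
  refine this.congr_fun fun j => ?_
  rw [← hG.inner_left_eq_inner_right, hv, inner_smul_left, real_inner_comm u]
  simp only [conj_trivial]; ring

lemma hasSum_sqNorm_contraction (hG : G.IsPositive) (hv : ∀ j, G (v j) = μ j • v j) (η : ℕ → ℝ)
    (t : ℕ) (u : E) :
    HasSum (fun j => μ j * decay η (μ j) 0 t ^ 2 * ⟪v j, u⟫ ^ 2)
      (sqNorm G (contraction η G t u)) := by
  refine (hasSum_sqNorm hG hv (contraction η G t u)).congr_fun fun j => ?_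
  rw [inner_contraction hG hv]; ring

/-- `tr(G P A P)`, where `P = ∏_{s ≤ k < t} (I - η_k G)`. -/
def contractedTrace (v : HilbertBasis ι ℝ E) (μ : ι → ℝ) (η : ℕ → ℝ) (s t : ℕ)
    (A : E →L[ℝ] E) : ℝ := ∑' j, μ j * decay η (μ j) s t ^ 2 * ⟪v j, A (v j)⟫

/-- `I - η_t G` scales `v j`, so the congruence multiplies each diagonal entry by the squared factor
that extends `decay` by one step. -/
lemma contractedTrace_conj (hv : ∀ j, G (v j) = μ j • v j) (η : ℕ → ℝ) {s t : ℕ} (hst : s ≤ t)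
    (A : E →L[ℝ] E) :
    contractedTrace v μ η s t (conj (ContinuousLinearMap.id ℝ E - η t • G) A) =
      contractedTrace v μ η s (t + 1) A := by
  refine tsum_congr fun j => ?_
  have h : (ContinuousLinearMap.id ℝ E - η t • G) (v j) = (1 - η t * μ j) • v j := by
    rw [sub_apply, smul_apply, hv, ContinuousLinearMap.id_apply]; module
  rw [decay_succ _ _ hst, inner_conj, h, map_smul, inner_smul_left, inner_smul_right]
  simp only [conj_trivial]; ring

/-- The solution of the energy recursion with forcing `q`. -/
def unrolledEnergy (v : HilbertBasis ι ℝ E) (μ : ι → ℝ) (G : E →L[ℝ] E) (η q : ℕ → ℝ) (u : E)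
    (t : ℕ) (A : E →L[ℝ] E) : ℝ :=
  sqNorm A (contraction η G t u) +
    ∑ s ∈ Finset.range t, η s ^ 2 * q s * contractedTrace v μ η (s + 1) t A

lemma unrolledEnergy_zero (η q : ℕ → ℝ) (u : E) (A : E →L[ℝ] E) :
    unrolledEnergy v μ G η q u 0 A = sqNorm A u := by simp [unrolledEnergy, contraction]

lemma unrolledEnergy_succ (hv : ∀ j, G (v j) = μ j • v j) (η q : ℕ → ℝ) (u : E) (t : ℕ)
    (A : E →L[ℝ] E) :
    unrolledEnergy v μ G η q u (t + 1) A =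
      unrolledEnergy v μ G η q u t (conj (ContinuousLinearMap.id ℝ E - η t • G) A) +
        η t ^ 2 * q t * ∑' j, μ j * ⟪v j, A (v j)⟫ := by
  rw [unrolledEnergy, unrolledEnergy, Finset.sum_range_succ, ← add_assoc]
  congr 1
  · congr 1
    · rw [sqNorm, sqNorm, inner_conj, contraction_succ_apply]
    · refine Finset.sum_congr rfl fun s hs => ?_
      rw [contractedTrace_conj hv η (Nat.succ_le_of_lt (Finset.mem_range.1 hs))]
  · simp [contractedTrace, decay]

end Unrolling

/-! ### From single eigenvalues to traces and quadratic forms. -/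

section Spectrum

variable {E : Type*} [NormedAddCommGroup E] [InnerProductSpace ℝ E] [CompleteSpace E]
  {ι : Type*}

/-- `v` is an eigenbasis of the positive operator `G`, with eigenvalues `μ` and trace `T`. -/
structure IsEigenbasis (v : HilbertBasis ι ℝ E) (μ : ι → ℝ) (G : E →L[ℝ] E) (T : ℝ) : Prop where
  isPositive : G.IsPositive
  eigen : ∀ j, G (v j) = μ j • v j
  pos : ∀ j, 0 < μ j
  hasSum : HasSum μ T

variable {v : HilbertBasis ι ℝ E} {μ : ι → ℝ} {G : E →L[ℝ] E} {T : ℝ}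

lemma IsEigenbasis.le_trace (h : IsEigenbasis v μ G T) (j : ι) : μ j ≤ T :=
  le_hasSum h.hasSum j fun i _ => (h.pos i).le

lemma IsEigenbasis.inner_eq (h : IsEigenbasis v μ G T) (j : ι) : ⟪v j, G (v j)⟫ = μ j := by
  rw [h.eigen, inner_smul_right, real_inner_self_eq_norm_sq, v.orthonormal.1]; simp

lemma summable_inner_sq (v : HilbertBasis ι ℝ E) (u : E) : Summable fun j => ⟪v j, u⟫ ^ 2 := by
  refine (v.summable_inner_mul_inner u u).congr fun j => ?_
  rw [real_inner_comm (v j) u, sq]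

lemma summable_mul_inner_sq (v : HilbertBasis ι ℝ E) (u : E) {φ : ι → ℝ} {c : ℝ}
    (h0 : ∀ j, 0 ≤ φ j) (hc : ∀ j, φ j ≤ c) : Summable fun j => φ j * ⟪v j, u⟫ ^ 2 :=
  ((summable_inner_sq v u).mul_left c).of_nonneg_of_le
    (fun j => mul_nonneg (h0 j) (sq_nonneg _))
    fun j => mul_le_mul_of_nonneg_right (hc j) (sq_nonneg _)

variable {η : ℕ → ℝ}

/-- Summability matters: without it the `tsum` in `contractedTrace` could default to `0`. -/
lemma hasSum_contractedTrace (h : IsEigenbasis v μ G T) (hη0 : ∀ k, 0 ≤ η k)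
    (hη : ∀ k j, η k * μ j ≤ 1 / 4) {A : E →L[ℝ] E} (hA : A.IsPositive)
    (hsum : Summable fun j => μ j * ⟪v j, A (v j)⟫) (s t : ℕ) :
    HasSum (fun j => μ j * decay η (μ j) s t ^ 2 * ⟪v j, A (v j)⟫)
      (contractedTrace v μ η s t A) := by
  refine (hsum.of_nonneg_of_le (fun j => ?_) fun j => ?_).hasSum
  · exact mul_nonneg (mul_nonneg (h.pos j).le (sq_nonneg _)) (hA.inner_nonneg_right _)
  · have := decay_sq_le_one (fun k => mul_nonneg (hη0 k) (h.pos j).le) (fun k => hη k j) s t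
    exact mul_le_mul_of_nonneg_right (mul_le_of_le_one_right (h.pos j).le this)
      (hA.inner_nonneg_right _)

lemma IsEigenbasis.summable_mul (h : IsEigenbasis v μ G T) :
    Summable fun j => μ j * ⟪v j, G (v j)⟫ := by
  simp_rw [h.inner_eq]
  exact (h.hasSum.summable.mul_left T).of_nonneg_of_le
    (fun j => mul_nonneg (h.pos j).le (h.pos j).le)
    fun j => mul_le_mul_of_nonneg_right (h.le_trace j) (h.pos j).le

lemma contractedTrace_nonneg (h : IsEigenbasis v μ G T) {A : E →L[ℝ] E} (hA : A.IsPositive)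
    (s t : ℕ) : 0 ≤ contractedTrace v μ η s t A :=
  tsum_nonneg fun j =>
    mul_nonneg (mul_nonneg (h.pos j).le (sq_nonneg _)) (hA.inner_nonneg_right _)

/-- Bounds on weighted sums of squared contraction factors that are uniform over the spectrum
carry over to the traces `tr(G P G P)`. -/
lemma sum_mul_contractedTrace_le (h : IsEigenbasis v μ G T) (hη0 : ∀ k, 0 ≤ η k)
    (hη : ∀ k j, η k * μ j ≤ 1 / 4) {κ : Type*} (F : Finset κ) (a : κ → ℝ) (s t : κ → ℕ) {c : ℝ}
    (hc : ∀ j, ∑ i ∈ F, a i * μ j * decay η (μ j) (s i) (t i) ^ 2 ≤ c) :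
    ∑ i ∈ F, a i * contractedTrace v μ η (s i) (t i) G ≤ c * T := by
  have h1 : HasSum (fun j => ∑ i ∈ F, a i * (μ j * decay η (μ j) (s i) (t i) ^ 2 *
      ⟪v j, G (v j)⟫)) (∑ i ∈ F, a i * contractedTrace v μ η (s i) (t i) G) :=
    hasSum_sum fun i _ =>
      (hasSum_contractedTrace h hη0 hη h.isPositive h.summable_mul (s i) (t i)).mul_left (a i)
  refine hasSum_le (fun j => ?_) h1 (h.hasSum.mul_left c)
  simp_rw [h.inner_eq, ← mul_assoc]
  rw [← Finset.sum_mul]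
  exact mul_le_mul_of_nonneg_right (hc j) (h.pos j).le

lemma sqNorm_contraction_antitone (h : IsEigenbasis v μ G T) (hη0 : ∀ k, 0 ≤ η k)
    (hη : ∀ k j, η k * μ j ≤ 1 / 4) (u : E) :
    Antitone fun t => sqNorm G (contraction η G t u) := fun s t hst =>
  hasSum_le (fun j => by
    have h1 := decay_le_decay (fun k => mul_nonneg (hη0 k) (h.pos j).le) (fun k => hη k j) 0 hst
    have h2 := decay_nonneg (fun k => hη k j) 0 t
    have h3 := (h.pos j).le
    gcongr) (hasSum_sqNorm_contraction h.isPositive h.eigen η t u)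
    (hasSum_sqNorm_contraction h.isPositive h.eigen η s u)

variable {M : ℕ} {γ α σ : ℝ}

lemma IsEigenbasis.stepsize_mul_le (h : IsEigenbasis v μ G T) (hγ : 0 < γ) (hγT : γ * T ≤ 1 / 4)
    (k : ℕ) (j : ι) : stepsize M γ k * μ j ≤ 1 / 4 :=
  CovShift.stepsize_mul_le hγ (h.pos j)
    ((mul_le_mul_of_nonneg_left (h.le_trace j) hγ.le).trans hγT) k

lemma headConstTail_nonneg (h : IsEigenbasis v μ G T) {a : ℝ} (ha : 0 ≤ a) (J : Set ι) (j : ι) :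
    0 ≤ headConstTail a μ J j := by
  by_cases hj : j ∈ J
  · simpa [headConstTail, tail, hj] using ha
  · simpa [headConstTail, tail, hj] using (h.pos j).le

lemma headConstTail_le (h : IsEigenbasis v μ G T) {a : ℝ} (ha : 0 ≤ a) (J : Set ι) (j : ι) :
    headConstTail a μ J j ≤ a + T := by
  have h1 := h.le_trace j
  have h2 := h.pos j
  by_cases hj : j ∈ J
  · simp only [headConstTail, tail, hj, Set.indicator_of_mem, Set.mem_compl_iff, not_true_eq_false,
      not_false_eq_true, Set.indicator_of_notMem]
    linarith
  · simp only [headConstTail, tail, hj, Set.indicator_of_mem, Set.mem_compl_iff,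
      not_false_eq_true, Set.indicator_of_notMem]
    linarith

lemma tail_nonneg (h : IsEigenbasis v μ G T) (J : Set ι) (j : ι) : 0 ≤ tail μ J j :=
  Set.indicator_nonneg (fun i _ => (h.pos i).le) j

lemma tail_le (h : IsEigenbasis v μ G T) (J : Set ι) (j : ι) : tail μ J j ≤ T :=
  (Set.indicator_le_self' (fun i _ => (h.pos i).le) j).trans (h.le_trace j)

/-- The excess energy accumulated along the deterministic iteration. -/
lemma sum_stepsize_mul_sqNorm_le (h : IsEigenbasis v μ G T) (hM : 100 < M) (hγ : 0 < γ)
    (hγT : γ * T ≤ 1 / 4) (J : Set ι) (u : E) :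
    ∑ t ∈ Finset.range M, stepsize M γ t * sqNorm G (contraction (stepsize M γ) G t u) ≤
      4 * γ * effSamples M *
        ∑' j, headConstTail (1 / (effSamples M * γ)) μ J j * ⟪v j, u⟫ ^ 2 := by
  have hm := two_le_effSamples hM
  have ha : 0 ≤ 1 / (effSamples M * γ) := by positivity
  have h1 : HasSum (fun j => ∑ t ∈ Finset.range M, stepsize M γ t *
      (μ j * decay (stepsize M γ) (μ j) 0 t ^ 2 * ⟪v j, u⟫ ^ 2))
      (∑ t ∈ Finset.range M, stepsize M γ t * sqNorm G (contraction (stepsize M γ) G t u)) :=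
    hasSum_sum fun t _ =>
      (hasSum_sqNorm_contraction h.isPositive h.eigen (stepsize M γ) t u).mul_left _
  have h2 := (summable_mul_inner_sq v u (headConstTail_nonneg h ha J)
    (headConstTail_le h ha J)).hasSum.mul_left (4 * γ * effSamples M)
  refine hasSum_le (fun j => ?_) h1 h2
  have hμ := h.pos j
  have hu0 := stepsize_mul_nonneg (M := M) hγ hμ
  have hu := fun k => h.stepsize_mul_le (M := M) hγ hγT k j
  simp_rw [← mul_assoc]
  rw [← Finset.sum_mul]
  refine mul_le_mul_of_nonneg_right ?_ (sq_nonneg _)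
  -- On `J` the contracted sum is at most `1`; off `J` contraction is dropped and the stepsizes
  -- total at most `4 m γ`.
  by_cases hj : j ∈ J
  · have : 4 * γ * effSamples M * headConstTail (1 / (effSamples M * γ)) μ J j = 4 := by
      simp only [headConstTail, tail, hj, Set.indicator_of_mem, Set.mem_compl_iff,
        not_true_eq_false, not_false_eq_true, Set.indicator_of_notMem]
      field_simp; norm_num
    rw [this, Finset.range_eq_Ico]
    linarith [sum_Ico_mul_decay_sq_le hu0 hu (Nat.zero_le M)]
  · have : 4 * γ * effSamples M * headConstTail (1 / (effSamples M * γ)) μ J j =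
        4 * effSamples M * γ * μ j := by
      simp only [headConstTail, tail, hj, Set.indicator_of_mem, Set.mem_compl_iff,
        not_false_eq_true, Set.indicator_of_notMem]
      ring
    rw [this]
    calc _ ≤ ∑ t ∈ Finset.range M, stepsize M γ t * μ j := by
          refine Finset.sum_le_sum fun t _ => ?_
          exact mul_le_of_le_one_right (hu0 t) (decay_sq_le_one hu0 hu 0 t)
      _ = (∑ t ∈ Finset.range M, stepsize M γ t) * μ j := by rw [Finset.sum_mul]
      _ ≤ _ := by
          gcongr
          rw [Finset.range_eq_Ico]
          refine (sum_stepsize_le hM hγ 0 M).trans ?_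
          have := stepsize_le (M := M) hγ 0
          gcongr

lemma noise_level_bounds (h : IsEigenbasis v μ G T) (hM : 100 < M) (hγ : 0 < γ) (hα : 1 ≤ α)
    (hαT : 4 * α * γ * T ≤ 1) (J : Set ι) (u : E) {q : ℕ → ℝ} (hq : ∀ t, 0 ≤ q t)
    (hrec : ∀ t ≤ M, q t ≤
      α * unrolledEnergy v μ G (stepsize M γ) (fun s => 2 * q s) u t G + σ ^ 2) :
    let Q := 4 * γ * effSamples M * (α * ∑' j, headConstTail (1 / (effSamples M * γ)) μ J j *
      ⟪v j, u⟫ ^ 2 + σ ^ 2)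
    ∑ t ∈ Finset.range M, stepsize M γ t * q t ≤ 2 * Q ∧
      ∀ s < M, (∑ k ∈ Finset.range s, stepsize M γ k) * q s ≤ 3 * Q := by
  intro Q
  have hm := two_le_effSamples hM
  have hT : 0 ≤ T := h.hasSum.nonneg fun j => (h.pos j).le
  have hγT : γ * T ≤ 1 / 4 := by nlinarith [mul_nonneg hγ.le hT]
  have hη0 := fun k => (stepsize_pos (M := M) hγ k).le
  have hη : ∀ k j, stepsize M γ k * μ j ≤ 1 / 4 := h.stepsize_mul_le hγ hγT
  have hu0 : ∀ j k, 0 ≤ stepsize M γ k * μ j := fun j k => mul_nonneg (hη0 k) (h.pos j).le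
  have hb0 : ∀ t, 0 ≤ sqNorm G (contraction (stepsize M γ) G t u) := fun t =>
    sqNorm_nonneg h.isPositive _
  set p : ℕ → ℝ := fun t => α * sqNorm G (contraction (stepsize M γ) G t u) + σ ^ 2 with hp
  have hp0 : ∀ t, 0 ≤ p t := fun t => by have := hb0 t; simp only [hp]; positivity
  have hanti : Antitone p := fun s t hst => by
    have := sqNorm_contraction_antitone h hη0 hη u hst
    simp only [hp]; gcongr
  have hsum : ∑ t ∈ Finset.range M, stepsize M γ t * p t ≤ Q := by
    have h1 := sum_stepsize_mul_sqNorm_le h hM hγ hγT J u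
    have h2 := sum_stepsize_le hM hγ 0 M
    have h3 := stepsize_le (M := M) hγ 0
    rw [← Finset.range_eq_Ico] at h2
    have h4 : ∑ t ∈ Finset.range M, stepsize M γ t * p t =
        α * ∑ t ∈ Finset.range M, stepsize M γ t *
          sqNorm G (contraction (stepsize M γ) G t u) +
        (∑ t ∈ Finset.range M, stepsize M γ t) * σ ^ 2 := by
      rw [Finset.mul_sum, Finset.sum_mul, ← Finset.sum_add_distrib]
      exact Finset.sum_congr rfl fun t _ => by simp only [hp]; ring
    have h5 : ∑ t ∈ Finset.range M, stepsize M γ t ≤ 4 * effSamples M * γ :=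
      h2.trans (by gcongr)
    rw [h4]
    have h6 := mul_le_mul_of_nonneg_left h1 (zero_le_one.trans hα)
    have h7 := mul_le_mul_of_nonneg_right h5 (sq_nonneg σ)
    simp only [Q]
    linarith
  refine volterra_bounds (γ := γ) (α := α) (T := T) (p := p)
    (K := fun t s => contractedTrace v μ (stepsize M γ) (t + 1) s G) hη0 (stepsize_le hγ)
    (zero_le_one.trans hα) hαT hq (fun t s => contractedTrace_nonneg h h.isPositive _ _)
    ((Finset.sum_nonneg fun t _ => mul_nonneg (hη0 t) (hp0 t)).trans hsum) ?_ hsum ?_ ?_ ?_ ?_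
  · intro s hs
    refine (hrec s hs.le).trans_eq ?_
    simp only [hp, unrolledEnergy]
    rw [mul_add, mul_assoc 2 α, mul_left_comm 2 α, Finset.mul_sum (a := (2 : ℝ))]
    have : ∀ i ∈ Finset.range s, stepsize M γ i ^ 2 * (2 * q i) *
        contractedTrace v μ (stepsize M γ) (i + 1) s G = 2 * (stepsize M γ i ^ 2 * q i *
        contractedTrace v μ (stepsize M γ) (i + 1) s G) := fun i _ => by ring
    rw [Finset.sum_congr rfl this]
    ring
  -- The forcing decreases in time, so its value at `s` times the elapsed stepsizes is at most its
  -- weighted sum up to `s`.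
  · intro s hs
    rw [Finset.sum_mul]
    refine le_trans ?_ hsum
    calc _ ≤ ∑ t ∈ Finset.range s, stepsize M γ t * p t :=
          Finset.sum_le_sum fun t ht => mul_le_mul_of_nonneg_left
            (hanti (Finset.mem_range.1 ht).le) (hη0 t)
      _ ≤ _ := Finset.sum_le_sum_of_subset_of_nonneg (Finset.range_subset_range.2 hs.le)
          fun t _ _ => mul_nonneg (hη0 t) (hp0 t)
  · intro s
    have := sum_mul_contractedTrace_le h hη0 hη (Finset.range s) (stepsize M γ) (fun t => t + 1)
      (fun _ => s) (c := 1) fun j => sum_mul_decay_sq_le (hu0 j) (fun k => hη k j) s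
    rwa [one_mul] at this
  · intro t ht
    have := sum_mul_contractedTrace_le h hη0 hη (Finset.Ico (t + 1) M) (stepsize M γ)
      (fun _ => t + 1) (fun s => s) (c := 1) fun j =>
        sum_Ico_mul_decay_sq_le (hu0 j) (fun k => hη k j) ht
    rwa [one_mul] at this
  · intro t s hts
    have := sum_mul_contractedTrace_le h hη0 hη (Finset.univ : Finset Unit)
      (fun _ => ∑ k ∈ Finset.Ico t s, stepsize M γ k) (fun _ => t + 1) (fun _ => s) (c := 1 / 2)
      fun j => by simpa using sum_Ico_mul_decay_sq_succ_le (hu0 j) (fun k => hη k j) hts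
    simp only [Finset.univ_unique, Finset.sum_singleton] at this
    linarith

/-- The constant is `176 = 44 · 4`, with `Q = 4 γ m x`; off `J` already `8` would do. -/
lemma weightedSum_le (h : IsEigenbasis v μ G T) (hM : 100 < M) (hγ : 0 < γ)
    (hγT : γ * T ≤ 1 / 4) (J : Set ι) {q : ℕ → ℝ} {x : ℝ} (hq : ∀ t, 0 ≤ q t)
    (hsum : ∑ t ∈ Finset.range M, stepsize M γ t * q t ≤ 2 * (4 * γ * effSamples M * x))
    (hpt : ∀ t < M, (∑ k ∈ Finset.range t, stepsize M γ k) * q t ≤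
      3 * (4 * γ * effSamples M * x)) (hx : 0 ≤ x) (j : ι) :
    ∑ t ∈ Finset.range M, stepsize M γ t ^ 2 * q t *
        (μ j * decay (stepsize M γ) (μ j) (t + 1) M ^ 2) ≤
      176 * x / effSamples M * (headInv μ J j + effSamples M ^ 2 * γ ^ 2 * tail μ J j) := by
  have hm := two_le_effSamples hM
  have hμ := h.pos j
  have hγμ : γ * μ j ≤ 1 / 4 := (mul_le_mul_of_nonneg_left (h.le_trace j) hγ.le).trans hγT
  by_cases hj : j ∈ J
  · refine (weightedSum_le_head hM hγ hμ hγμ hq hsum hpt).trans_eq ?_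
    simp only [headInv, tail, hj, Set.indicator_of_mem, Set.mem_compl_iff,
        not_true_eq_false, not_false_eq_true, Set.indicator_of_notMem]
    field_simp; ring
  · refine (weightedSum_le_tail hγ hμ hγμ hq hsum).trans ?_
    simp only [headInv, tail, hj, Set.indicator_of_mem, Set.mem_compl_iff,
        not_false_eq_true, Set.indicator_of_notMem]
    have : 176 * x / effSamples M * (0 + effSamples M ^ 2 * γ ^ 2 * μ j) =
        176 * (x * effSamples M * γ ^ 2 * μ j) := by field_simp; ring
    rw [this]
    have : 0 ≤ x * effSamples M * γ ^ 2 * μ j := by positivity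
    linarith

lemma le_weightedSum (h : IsEigenbasis v μ G T) (hM : 100 < M) (hγ : 0 < γ)
    (hγT : γ * T ≤ 1 / 4) {J : Set ι} (hJ : J = {j | 1 / (γ * effSamples M) ≤ μ j}) (j : ι) :
    Real.exp (-32) / 2 / effSamples M *
        (headInv μ J j + effSamples M ^ 2 * γ ^ 2 * tail μ J j) ≤
      ∑ t ∈ Finset.range M, stepsize M γ t ^ 2 *
        (μ j * decay (stepsize M γ) (μ j) (t + 1) M ^ 2) := by
  have hm := two_le_effSamples hM
  have hμ := h.pos j
  have hγμ : γ * μ j ≤ 1 / 4 := (mul_le_mul_of_nonneg_left (h.le_trace j) hγ.le).trans hγT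
  have hiff : j ∈ J ↔ 1 ≤ γ * μ j * effSamples M := by
    rw [hJ, Set.mem_ofPred_eq, div_le_iff₀ (by positivity)]
    constructor <;> intro h' <;> linarith
  by_cases hj : j ∈ J
  · refine le_trans (le_of_eq ?_) (le_weightedSum_head hM hγ hμ hγμ (hiff.1 hj))
    simp only [headInv, tail, hj, Set.indicator_of_mem, Set.mem_compl_iff,
        not_true_eq_false, not_false_eq_true, Set.indicator_of_notMem]
    field_simp; ring
  · refine le_trans ?_ (le_weightedSum_tail hM hγ hμ hγμ (not_le.1 fun h' => hj (hiff.2 h')).le)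
    simp only [headInv, tail, hj, Set.indicator_of_mem, Set.mem_compl_iff,
        not_false_eq_true, Set.indicator_of_notMem]
    have h1 : Real.exp (-32) ≤ Real.exp (-16) := Real.exp_le_exp.2 (by norm_num)
    have : Real.exp (-32) / 2 / effSamples M * (0 + effSamples M ^ 2 * γ ^ 2 * μ j) =
        Real.exp (-32) / 2 * (effSamples M * γ ^ 2 * μ j) := by field_simp; ring
    rw [this]
    gcongr
    linarith [Real.exp_pos (-32)]

/-- Directions outside `J` satisfy `γ m μ < 1`, so the whole run contracts their squares by at most
a constant; those in `J` are dropped. -/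
lemma le_sqNorm_contraction (h : IsEigenbasis v μ G T) (hM : 100 < M) (hγ : 0 < γ)
    (hγT : γ * T ≤ 1 / 4) {J : Set ι} (hJ : J = {j | 1 / (γ * effSamples M) ≤ μ j}) (u : E)
    (t : ℕ) : Real.exp (-16) * ∑' j, tail μ J j * ⟪v j, u⟫ ^ 2 ≤
      sqNorm G (contraction (stepsize M γ) G t u) := by
  have hm := two_le_effSamples hM
  refine hasSum_le (fun j => ?_)
    ((summable_mul_inner_sq v u (tail_nonneg h J) (tail_le h J)).hasSum.mul_left _)
    (hasSum_sqNorm_contraction h.isPositive h.eigen (stepsize M γ) t u)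
  have hμ := h.pos j
  have hγμ : γ * μ j ≤ 1 / 4 := (mul_le_mul_of_nonneg_left (h.le_trace j) hγ.le).trans hγT
  rw [← mul_assoc]
  refine mul_le_mul_of_nonneg_right ?_ (sq_nonneg _)
  by_cases hj : j ∈ J
  · simp only [tail, hj, Set.mem_compl_iff, not_true_eq_false, not_false_eq_true,
      Set.indicator_of_notMem, mul_zero]
    positivity
  · simp only [tail, hj, Set.mem_compl_iff, not_false_eq_true, Set.indicator_of_mem]
    rw [mul_comm]
    gcongr
    have h1 : μ j < 1 / (γ * effSamples M) := by
      rw [hJ] at hj; simpa using hj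
    rw [lt_div_iff₀ (by positivity)] at h1
    have := exp_le_decay_sq hM hγ hμ hγμ (c := 1) (s := 0) ?_ t
    · simpa using this
    · have := stepsize_le (M := M) hγ 0
      calc _ ≤ effSamples M * (γ * μ j) := by gcongr
        _ ≤ 1 := by linarith

lemma weightedSq_eq_ofReal (v : HilbertBasis ι ℝ E) (u : E) {φ : ι → ℝ} {c : ℝ}
    (h0 : ∀ j, 0 ≤ φ j) (hc : ∀ j, φ j ≤ c) :
    weightedSq v φ u = ENNReal.ofReal (∑' j, φ j * ⟪v j, u⟫ ^ 2) :=
  (ENNReal.ofReal_tsum_of_nonneg (fun j => mul_nonneg (h0 j) (sq_nonneg _))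
    (summable_mul_inner_sq v u h0 hc)).symm

/-- A single extended series, so that comparisons can be made term by term even when the effective
dimension is infinite. -/
lemma effDim_eq (h : IsEigenbasis v μ G T) (J : Set ι) {H : E →L[ℝ] E} (hH : H.IsPositive)
    (m γ : ℝ) : effDim v μ J H m γ = ∑' j, ENNReal.ofReal
      ((headInv μ J j + m ^ 2 * γ ^ 2 * tail μ J j) * ⟪v j, H (v j)⟫) := by
  rw [effDim, weightedTrace, weightedTrace, ← ENNReal.tsum_mul_left, ← ENNReal.tsum_add]
  refine tsum_congr fun j => ?_
  have h1 := hH.inner_nonneg_right (v j)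
  have h2 : 0 ≤ headInv μ J j := Set.indicator_nonneg (fun i _ => (inv_pos.2 (h.pos i)).le) j
  have h3 := tail_nonneg h J j
  rw [← ENNReal.ofReal_mul (by positivity), ← ENNReal.ofReal_add (by positivity) (by positivity)]
  congr 1; ring

lemma hasSum_sum_mul_contractedTrace (h : IsEigenbasis v μ G T) (hγ : 0 < γ)
    (hγT : γ * T ≤ 1 / 4) {H : E →L[ℝ] E} (hH : H.IsPositive)
    (hsum : Summable fun j => μ j * ⟪v j, H (v j)⟫) (q : ℕ → ℝ) :
    HasSum (fun j => (∑ t ∈ Finset.range M, stepsize M γ t ^ 2 * q t *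
        (μ j * decay (stepsize M γ) (μ j) (t + 1) M ^ 2)) * ⟪v j, H (v j)⟫)
      (∑ t ∈ Finset.range M, stepsize M γ t ^ 2 * q t *
        contractedTrace v μ (stepsize M γ) (t + 1) M H) := by
  have := hasSum_sum (s := Finset.range M) fun t _ =>
    (hasSum_contractedTrace h (fun k => (stepsize_pos (M := M) hγ k).le)
      (h.stepsize_mul_le hγ hγT) hH hsum (t + 1) M).mul_left (stepsize M γ t ^ 2 * q t)
  refine this.congr_fun fun j => ?_
  rw [Finset.sum_mul]
  exact Finset.sum_congr rfl fun t _ => by ring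

end Spectrum

/-! ### The two risk bounds. -/

section Bounds

variable {E : Type*} [NormedAddCommGroup E] [InnerProductSpace ℝ E] [CompleteSpace E]
  [SecondCountableTopology E] [MeasurableSpace E] [BorelSpace E]
  {DS DT : Measure (E × ℝ)} [IsProbabilityMeasure DS] [IsProbabilityMeasure DT] {wStar : E}
  {ι : Type*} {v : HilbertBasis ι ℝ E} {μ : ι → ℝ} {α σ γ : ℝ} {M : ℕ}
  {Ω : Type*} [MeasurableSpace Ω] {P : Measure Ω} {Z : ℕ → Ω → E × ℝ}

lemma IsCovariateShift.isEigenbasis (hc : IsCovariateShift DS DT wStar)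
    (hv : ∀ j, secondMoment DS (v j) = μ j • v j) :
    IsEigenbasis v μ (secondMoment DS) (trace (secondMoment DS)) := by
  have hμ : ∀ j, ⟪v j, secondMoment DS (v j)⟫ = μ j := fun j => by
    rw [hv, inner_smul_right, real_inner_self_eq_norm_sq, v.orthonormal.1]; simp
  refine ⟨secondMoment_isPositive hc.source_moments.covariate, hv, fun j => ?_, ?_⟩
  · rw [← hμ]
    refine hc.source_pos _ fun h0 => ?_
    have := v.orthonormal.1 j
    simp [h0] at this
  · have := hasSum_inner_secondMoment_comp hc.source_moments.covariate
      (ContinuousLinearMap.id ℝ E) v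
    simp only [ContinuousLinearMap.id_apply, hμ, real_inner_self_eq_norm_sq] at this
    rwa [trace_secondMoment hc.source_moments.covariate]

lemma IsCovariateShift.stepsize_bounds (hc : IsCovariateShift DS DT wStar)
    (hv : ∀ j, secondMoment DS (v j) = μ j • v j) (h4 : FourthMomentUpper DS α) (hα : 0 < α)
    (hγ : 0 < γ) (hγα : γ < 1 / (4 * α * trace (secondMoment DS))) :
    1 ≤ α ∧ 4 * α * γ * trace (secondMoment DS) ≤ 1 ∧ γ * trace (secondMoment DS) ≤ 1 / 4 := by
  have h := hc.isEigenbasis hv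
  set T := trace (secondMoment DS)
  have hT0 : 0 ≤ T := h.hasSum.nonneg fun j => (h.pos j).le
  -- For `T = 0` the stepsize bound reads `γ < 1 / 0 = 0`, contradicting `0 < γ`.
  have hT : 0 < T := by
    refine lt_of_le_of_ne hT0 fun h0 => ?_
    rw [← h0] at hγα
    simp at hγα
    linarith
  have hα1 : 1 ≤ α := by
    have : Nonempty ι := by
      by_contra hι
      rw [not_nonempty_iff] at hι
      have h1 := h.hasSum.tsum_eq
      rw [tsum_empty] at h1
      linarith
    obtain ⟨j⟩ := this
    exact h4.one_le hc.source_moments (u := v j) (by rw [h.inner_eq]; exact h.pos j)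
  rw [lt_div_iff₀ (by positivity)] at hγα
  refine ⟨hα1, by linarith, ?_⟩
  nlinarith [mul_pos hγ hT]

/-- Besides its value, this gives the summability of `μ j * ⟪v j, H (v j)⟫`, with no relation
between the spectra of `G` and `H`. -/
lemma tsum_mul_inner_eq (h2 : FiniteSecondMoments DS)
    (hv : ∀ j, secondMoment DS (v j) = μ j • v j) (A : E →L[ℝ] E) :
    HasSum (fun j => μ j * ⟪v j, A (v j)⟫) (∫ p, ⟪p.1, A p.1⟫ ∂DS) := by
  refine (hasSum_inner_secondMoment_comp h2.covariate A v).congr_fun fun j => ?_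
  rw [← (secondMoment_isPositive h2.covariate).inner_left_eq_inner_right, hv, inner_smul_left]
  simp

section Energy

variable [IsProbabilityMeasure P]

lemma energy_toReal_le (hZ : ∀ t < M, HasLaw (Z t) DS P)
    (hi : iIndepFun (fun t : Fin M => Z t) P) (h2 : FiniteSecondMoments DS)
    (hmin : ∀ w, risk DS wStar ≤ risk DS w) (h4 : FourthMomentUpper DS α) (hα : 0 ≤ α)
    (hn : NoiseBound DS wStar σ) (hv : ∀ j, secondMoment DS (v j) = μ j • v j) (η : ℕ → ℝ)
    (w₀ : E) {t : ℕ} (ht : t ≤ M) {A : E →L[ℝ] E} (hA : IsConjMoment A) :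
    (energy P Z η w₀ wStar t A).toReal ≤ unrolledEnergy v μ (secondMoment DS) η
      (fun s => 2 * (α * (energy P Z η w₀ wStar s (secondMoment DS)).toReal + σ ^ 2))
      (w₀ - wStar) t A := by
  induction t generalizing A with
  | zero =>
    rw [energy_zero, unrolledEnergy_zero, ENNReal.toReal_ofReal (sqNorm_nonneg hA.isPositive _)]
  | succ t ih =>
    have htM : t ≤ M := Nat.le_of_lt ht
    have hG := isConjMoment_secondMoment h2.covariate
    have hA' := hA.conj (ContinuousLinearMap.id ℝ E - η t • secondMoment DS)
    have f1 := energy_ne_top hZ hi h2 hmin h4 hα hn η w₀ htM hA'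
    have f2 := energy_ne_top hZ hi h2 hmin h4 hα hn η w₀ htM hG
    have hT : 0 ≤ ∫ p, ⟪p.1, A p.1⟫ ∂DS := integral_nonneg fun p =>
      hA.isPositive.inner_nonneg_right p.1
    have h := ENNReal.toReal_mono (by finiteness)
      (energy_succ_le hZ hi h2 hmin h4 hα hn hA η w₀ ht)
    rw [ENNReal.toReal_add f1 (by finiteness), ENNReal.toReal_mul,
      ENNReal.toReal_add (by finiteness) (by finiteness), ENNReal.toReal_mul,
      ENNReal.toReal_ofReal (by positivity), ENNReal.toReal_ofReal hα,
      ENNReal.toReal_ofReal (sq_nonneg σ)] at h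
    rw [unrolledEnergy_succ hv, (tsum_mul_inner_eq h2 hv A).tsum_eq]
    linarith [ih htM hA']

lemma le_energy_toReal {β : ℝ} (hZ : ∀ t < M, HasLaw (Z t) DS P)
    (hi : iIndepFun (fun t : Fin M => Z t) P) (h2 : FiniteSecondMoments DS)
    (hmin : ∀ w, risk DS wStar ≤ risk DS w) (h4 : FourthMomentUpper DS α) (hα : 0 ≤ α)
    (hn : NoiseBound DS wStar σ) (h4' : FourthMomentLower DS β) (hβ : 0 ≤ β)
    (hw : WellSpecified DS wStar σ) (hv : ∀ j, secondMoment DS (v j) = μ j • v j) (η : ℕ → ℝ)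
    (w₀ : E) {t : ℕ} (ht : t ≤ M) {A : E →L[ℝ] E} (hA : IsConjMoment A) :
    unrolledEnergy v μ (secondMoment DS) η
      (fun s => β * (energy P Z η w₀ wStar s (secondMoment DS)).toReal + σ ^ 2)
      (w₀ - wStar) t A ≤ (energy P Z η w₀ wStar t A).toReal := by
  induction t generalizing A with
  | zero =>
    rw [energy_zero, unrolledEnergy_zero, ENNReal.toReal_ofReal (sqNorm_nonneg hA.isPositive _)]
  | succ t ih =>
    have htM : t ≤ M := Nat.le_of_lt ht
    have hG := isConjMoment_secondMoment h2.covariate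
    have hA' := hA.conj (ContinuousLinearMap.id ℝ E - η t • secondMoment DS)
    have f1 := energy_ne_top hZ hi h2 hmin h4 hα hn η w₀ htM hA'
    have f2 := energy_ne_top hZ hi h2 hmin h4 hα hn η w₀ htM hG
    have hT : 0 ≤ ∫ p, ⟪p.1, A p.1⟫ ∂DS := integral_nonneg fun p =>
      hA.isPositive.inner_nonneg_right p.1
    have h := ENNReal.toReal_mono (energy_ne_top hZ hi h2 hmin h4 hα hn η w₀ ht hA)
      (le_energy_succ hZ hi h2 hmin h4' hβ hn hw hA.isPositive η w₀ ht)
    rw [ENNReal.toReal_add f1 (by finiteness), ENNReal.toReal_mul,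
      ENNReal.toReal_add (by finiteness) (by finiteness), ENNReal.toReal_mul,
      ENNReal.toReal_ofReal (by positivity), ENNReal.toReal_ofReal hβ,
      ENNReal.toReal_ofReal (sq_nonneg σ)] at h
    rw [unrolledEnergy_succ hv, (tsum_mul_inner_eq h2 hv A).tsum_eq]
    linarith [ih htM hA']

end Energy

lemma lintegral_excessRisk (h2 : FiniteSecondMoments DT)
    (hmin : ∀ w, risk DT wStar ≤ risk DT w) (η : ℕ → ℝ) (w₀ : E) (t : ℕ) :
    ∫⁻ ω, ENNReal.ofReal (excessRisk DT wStar (sgd η w₀ (fun t => Z t ω) t)) ∂P =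
      ENNReal.ofReal (1 / 2) * energy P Z η w₀ wStar t (secondMoment DT) := by
  rw [energy, ← lintegral_const_mul' _ _ ENNReal.ofReal_ne_top]
  refine lintegral_congr fun ω => ?_
  rw [excessRisk_eq h2 hmin, ENNReal.ofReal_mul (by norm_num)]
  rfl

/-- Upper bound for the target excess risk of SGD on source data. -/
theorem excessRisk_le (hc : IsCovariateShift DS DT wStar)
    (hv : ∀ j, secondMoment DS (v j) = μ j • v j) (hα : 0 < α) (h4 : FourthMomentUpper DS α)
    (hn : NoiseBound DS wStar σ) (hM : 100 < M) (hγ : 0 < γ)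
    (hγα : γ < 1 / (4 * α * trace (secondMoment DS))) (hZ : ∀ t < M, HasLaw (Z t) DS P)
    (hi : iIndepFun (fun t : Fin M => Z t) P) (w₀ : E) (J : Set ι) :
    ∫⁻ ω, ENNReal.ofReal (excessRisk DT wStar (sgd (stepsize M γ) w₀ (fun t => Z t ω) M)) ∂P ≤
      ENNReal.ofReal 352 * (ENNReal.ofReal (sqNorm (secondMoment DT)
          (contraction (stepsize M γ) (secondMoment DS) M (w₀ - wStar))) +
        (ENNReal.ofReal α * weightedSq v (headConstTail (1 / (effSamples M * γ)) μ J)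
            (w₀ - wStar) + ENNReal.ofReal (σ ^ 2)) *
          (effDim v μ J (secondMoment DT) (effSamples M) γ / ENNReal.ofReal (effSamples M))) := by
  have := isProbabilityMeasure_of_hasLaw (by omega) hZ
  have h := hc.isEigenbasis hv
  obtain ⟨hα1, hαT, hγT⟩ := hc.stepsize_bounds hv h4 hα hγ hγα
  have hm := two_le_effSamples hM
  have h2 := hc.source_moments
  have hmin := hc.source_min
  have hHc := isConjMoment_secondMoment hc.target_moments.covariate
  have hH := hHc.isPositive
  set G := secondMoment DS
  set H := secondMoment DT
  set m := effSamples M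
  set u := w₀ - wStar
  set q : ℕ → ℝ := fun s => α * (energy P Z (stepsize M γ) w₀ wStar s G).toReal + σ ^ 2
  have hq : ∀ t, 0 ≤ q t := fun t => by positivity
  have ha : 0 ≤ 1 / (m * γ) := by positivity
  set B := ∑' j, headConstTail (1 / (m * γ)) μ J j * ⟪v j, u⟫ ^ 2
  have hB : 0 ≤ B := tsum_nonneg fun j => mul_nonneg (headConstTail_nonneg h ha J j) (sq_nonneg _)
  set x := α * B + σ ^ 2 with hx
  have hx0 : 0 ≤ x := by positivity
  obtain ⟨hsum, hpt⟩ := noise_level_bounds h hM hγ hα1 hαT J u hq fun t ht => by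
    have := energy_toReal_le hZ hi h2 hmin h4 hα.le hn hv (stepsize M γ) w₀ ht
      (isConjMoment_secondMoment h2.covariate)
    simp only [q]
    gcongr
  have hHsum := (tsum_mul_inner_eq h2 hv H).summable
  have hS := hasSum_sum_mul_contractedTrace (M := M) h hγ hγT hH hHsum q
  set S := ∑ t ∈ Finset.range M, stepsize M γ t ^ 2 * q t *
    contractedTrace v μ (stepsize M γ) (t + 1) M H
  have hE : energy P Z (stepsize M γ) w₀ wStar M H ≤
      ENNReal.ofReal (sqNorm H (contraction (stepsize M γ) G M u)) + ENNReal.ofReal (2 * S) := by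
    rw [← ENNReal.ofReal_toReal (energy_ne_top hZ hi h2 hmin h4 hα.le hn _ w₀ le_rfl hHc)]
    refine (ENNReal.ofReal_le_ofReal ?_).trans ENNReal.ofReal_add_le
    refine (energy_toReal_le hZ hi h2 hmin h4 hα.le hn hv (stepsize M γ) w₀ le_rfl hHc).trans_eq ?_
    rw [unrolledEnergy, Finset.mul_sum]
    congr 1
    exact Finset.sum_congr rfl fun t _ => by simp only [q]; ring
  -- `S` enters the energy bound doubled, whence `352 = 2 · 176`.
  have hSle : ENNReal.ofReal S ≤ ENNReal.ofReal (176 * x / m) * effDim v μ J H m γ := by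
    rw [effDim_eq h J hH, ← ENNReal.tsum_mul_left, ← hS.tsum_eq, ENNReal.ofReal_tsum_of_nonneg
      (fun j => mul_nonneg (Finset.sum_nonneg fun t _ => mul_nonneg (mul_nonneg (sq_nonneg _)
        (hq t)) (mul_nonneg (h.pos j).le (sq_nonneg _))) (hH.inner_nonneg_right _)) hS.summable]
    refine ENNReal.tsum_le_tsum fun j => ?_
    rw [← ENNReal.ofReal_mul (by positivity), ← mul_assoc]
    exact ENNReal.ofReal_le_ofReal (mul_le_mul_of_nonneg_right
      (weightedSum_le h hM hγ hγT J hq hsum hpt hx0 j) (hH.inner_nonneg_right _))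
  rw [lintegral_excessRisk hc.target_moments hc.target_min,
    weightedSq_eq_ofReal v u (headConstTail_nonneg h ha J) (headConstTail_le h ha J),
    ← ENNReal.ofReal_mul hα.le, ← ENNReal.ofReal_add (by positivity) (sq_nonneg σ), ← hx]
  calc _ ≤ 1 * (ENNReal.ofReal (sqNorm H (contraction (stepsize M γ) G M u)) +
        ENNReal.ofReal (2 * S)) := by
        gcongr; rw [← ENNReal.ofReal_one]; exact ENNReal.ofReal_le_ofReal (by norm_num)
    _ ≤ ENNReal.ofReal 352 * ENNReal.ofReal (sqNorm H (contraction (stepsize M γ) G M u)) +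
        ENNReal.ofReal 352 * (ENNReal.ofReal x *
          (effDim v μ J H m γ / ENNReal.ofReal m)) := by
        rw [one_mul]
        refine add_le_add (le_mul_of_one_le_left' ?_) ?_
        · rw [← ENNReal.ofReal_one]; exact ENNReal.ofReal_le_ofReal (by norm_num)
        · rw [ENNReal.ofReal_mul two_pos.le]
          refine (mul_le_mul_right hSle _).trans_eq ?_
          rw [ENNReal.ofReal_div_of_pos (by linarith), ENNReal.ofReal_mul (by norm_num),
            show (352 : ℝ) = 2 * 176 by norm_num, ENNReal.ofReal_mul (by norm_num)]
          simp only [div_eq_mul_inv]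
          ring
    _ = _ := by rw [mul_add]

/-- Lower bound for the target excess risk of SGD on source data. -/
theorem le_excessRisk {β : ℝ} (hc : IsCovariateShift DS DT wStar)
    (hv : ∀ j, secondMoment DS (v j) = μ j • v j) (hα : 0 < α) (h4 : FourthMomentUpper DS α)
    (hn : NoiseBound DS wStar σ) (hM : 100 < M) (hγ : 0 < γ)
    (hγα : γ < 1 / (4 * α * trace (secondMoment DS))) (hZ : ∀ t < M, HasLaw (Z t) DS P)
    (hi : iIndepFun (fun t : Fin M => Z t) P) (w₀ : E) (hβ : 0 < β)
    (h4' : FourthMomentLower DS β) (hw : WellSpecified DS wStar σ) {J : Set ι}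
    (hJ : J = {j | 1 / (γ * effSamples M) ≤ μ j}) :
    ENNReal.ofReal (Real.exp (-48) / 4) * (ENNReal.ofReal (sqNorm (secondMoment DT)
          (contraction (stepsize M γ) (secondMoment DS) M (w₀ - wStar))) +
        (ENNReal.ofReal β * weightedSq v (tail μ J) (w₀ - wStar) + ENNReal.ofReal (σ ^ 2)) *
          (effDim v μ J (secondMoment DT) (effSamples M) γ / ENNReal.ofReal (effSamples M))) ≤
    ∫⁻ ω, ENNReal.ofReal
      (excessRisk DT wStar (sgd (stepsize M γ) w₀ (fun t => Z t ω) M)) ∂P := by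
  have := isProbabilityMeasure_of_hasLaw (by omega) hZ
  have h := hc.isEigenbasis hv
  obtain ⟨hα1, hαT, hγT⟩ := hc.stepsize_bounds hv h4 hα hγ hγα
  have hm := two_le_effSamples hM
  have h2 := hc.source_moments
  have hmin := hc.source_min
  have hGc := isConjMoment_secondMoment h2.covariate
  have hHc := isConjMoment_secondMoment hc.target_moments.covariate
  have hH := hHc.isPositive
  set G := secondMoment DS
  set H := secondMoment DT
  set m := effSamples M
  set u := w₀ - wStar
  set B := ∑' j, tail μ J j * ⟪v j, u⟫ ^ 2 with hBdef
  have hB : 0 ≤ B := tsum_nonneg fun j => mul_nonneg (tail_nonneg h J j) (sq_nonneg _)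
  set x := β * B + σ ^ 2 with hx
  have hx0 : 0 ≤ x := by positivity
  set q : ℕ → ℝ := fun s => β * (energy P Z (stepsize M γ) w₀ wStar s G).toReal + σ ^ 2
  have hq0 : ∀ s, 0 ≤ q s := fun s => by positivity
  have hct : ∀ s t, 0 ≤ contractedTrace v μ (stepsize M γ) s t G := fun s t =>
    contractedTrace_nonneg h hGc.isPositive s t
  -- Only the deterministic part of the `G`-energy is used; its tail components survive up to the
  -- factor `exp (-16)`.
  have hq : ∀ t ≤ M, Real.exp (-16) * x ≤ q t := fun t ht => by
    have h1 := le_energy_toReal hZ hi h2 hmin h4 hα.le hn h4' hβ.le hw hv (stepsize M γ) w₀ ht hGc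
    have h3 := le_sqNorm_contraction h hM hγ hγT hJ u t
    have h5 : sqNorm G (contraction (stepsize M γ) G t u) ≤
        (energy P Z (stepsize M γ) w₀ wStar t G).toReal :=
      le_trans (le_add_of_nonneg_right (Finset.sum_nonneg fun s _ =>
        mul_nonneg (mul_nonneg (sq_nonneg _) (hq0 s)) (hct _ _))) h1
    have h6 : Real.exp (-16) ≤ 1 := Real.exp_le_one_iff.2 (by norm_num)
    have h7 := mul_le_mul_of_nonneg_left (h3.trans h5) hβ.le
    have h8 := mul_le_mul_of_nonneg_right h6 (sq_nonneg σ)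
    simp only [q, hx]
    linarith
  have hHsum := (tsum_mul_inner_eq h2 hv H).summable
  have hS := hasSum_sum_mul_contractedTrace (M := M) h hγ hγT hH hHsum fun _ => 1
  simp only [mul_one] at hS
  set S := ∑ t ∈ Finset.range M, stepsize M γ t ^ 2 *
    contractedTrace v μ (stepsize M γ) (t + 1) M H
  have hE : sqNorm H (contraction (stepsize M γ) G M u) + Real.exp (-16) * x * S ≤
      (energy P Z (stepsize M γ) w₀ wStar M H).toReal := by
    refine le_trans ?_ (le_energy_toReal hZ hi h2 hmin h4 hα.le hn h4' hβ.le hw hv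
      (stepsize M γ) w₀ le_rfl hHc)
    rw [unrolledEnergy, Finset.mul_sum]
    refine add_le_add le_rfl (Finset.sum_le_sum fun t ht => ?_)
    have h1 := hq t (Finset.mem_range.1 ht).le
    have h3 := contractedTrace_nonneg (η := stepsize M γ) h hH (t + 1) M
    calc _ = stepsize M γ t ^ 2 * (Real.exp (-16) * x) *
          contractedTrace v μ (stepsize M γ) (t + 1) M H := by ring
      _ ≤ _ := by gcongr
  have hSle : ENNReal.ofReal (Real.exp (-32) / 2 / m) * effDim v μ J H m γ ≤ ENNReal.ofReal S := by
    rw [effDim_eq h J hH, ← ENNReal.tsum_mul_left, ← hS.tsum_eq, ENNReal.ofReal_tsum_of_nonneg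
      (fun j => mul_nonneg (Finset.sum_nonneg fun t _ => mul_nonneg (sq_nonneg _)
        (mul_nonneg (h.pos j).le (sq_nonneg _))) (hH.inner_nonneg_right _)) hS.summable]
    refine ENNReal.tsum_le_tsum fun j => ?_
    rw [← ENNReal.ofReal_mul (by positivity), ← mul_assoc]
    exact ENNReal.ofReal_le_ofReal (mul_le_mul_of_nonneg_right
      (le_weightedSum h hM hγ hγT hJ j) (hH.inner_nonneg_right _))
  have hS0 : 0 ≤ S := Finset.sum_nonneg fun t _ =>
    mul_nonneg (sq_nonneg _) (contractedTrace_nonneg h hH _ _)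
  rw [lintegral_excessRisk hc.target_moments hc.target_min,
    weightedSq_eq_ofReal v u (tail_nonneg h J) (tail_le h J),
    ← ENNReal.ofReal_mul hβ.le, ← ENNReal.ofReal_add (by positivity) (sq_nonneg σ), ← hx,
    ← ENNReal.ofReal_toReal (energy_ne_top hZ hi h2 hmin h4 hα.le hn _ w₀ le_rfl hHc)]
  calc _ = ENNReal.ofReal (Real.exp (-48) / 4) *
          ENNReal.ofReal (sqNorm H (contraction (stepsize M γ) G M u)) +
        ENNReal.ofReal (1 / 2) * (ENNReal.ofReal (Real.exp (-16) * x) *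
          (ENNReal.ofReal (Real.exp (-32) / 2 / m) * effDim v μ J H m γ)) := by
        -- The factors come from the `1/2` in the risk, the lower bound on `q`, and
        -- `le_weightedSum`.
        have h48 : Real.exp (-48) / 4 = 1 / 2 * Real.exp (-16) * (Real.exp (-32) / 2) := by
          have : Real.exp (-48) = Real.exp (-16) * Real.exp (-32) := by
            rw [← Real.exp_add]; norm_num
          rw [this]; ring
        rw [mul_add]
        congr 1
        rw [h48, ENNReal.ofReal_mul (by positivity), ENNReal.ofReal_mul (by positivity),
          ENNReal.ofReal_mul (p := Real.exp (-16)) (q := x) (by positivity),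
          ENNReal.ofReal_div_of_pos (x := Real.exp (-32) / 2) (y := m) (by linarith)]
        simp only [div_eq_mul_inv]
        ring
    _ ≤ ENNReal.ofReal (1 / 2) *
          ENNReal.ofReal (sqNorm H (contraction (stepsize M γ) G M u)) +
        ENNReal.ofReal (1 / 2) * (ENNReal.ofReal (Real.exp (-16) * x) * ENNReal.ofReal S) := by
        have h48 : Real.exp (-48) ≤ 1 := Real.exp_le_one_iff.2 (by norm_num)
        gcongr
        linarith
    _ = ENNReal.ofReal (1 / 2) * ENNReal.ofReal (sqNorm H (contraction (stepsize M γ) G M u) +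
          Real.exp (-16) * x * S) := by
        rw [ENNReal.ofReal_add (sqNorm_nonneg hH _) (by positivity),
          ENNReal.ofReal_mul (p := Real.exp (-16) * x) (by positivity), mul_add (ENNReal.ofReal (1 / 2))]
    _ ≤ _ := by gcongr

end Bounds

end CovShift

end

theorem corollary3 :
    ∃ C c : ℝ≥0, 0 < C ∧ 0 < c ∧
      ∀ (E : Type*) [NormedAddCommGroup E] [InnerProductSpace ℝ E] [CompleteSpace E]
        [SecondCountableTopology E] [MeasurableSpace E] [BorelSpace E]
        (DS DT : Measure (E × ℝ)) [IsProbabilityMeasure DS] [IsProbabilityMeasure DT]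
        (wStar : E) (_ : CovShift.IsCovariateShift DS DT wStar)
        -- an orthonormal eigenbasis of the source covariance, with its eigenvalues
        (ι : Type*) (v : HilbertBasis ι ℝ E) (μ : ι → ℝ)
        (_ : ∀ j, CovShift.secondMoment DS (v j) = μ j • v j)
        (α σ : ℝ) (_ : 0 < α) (_ : 0 < σ)
        (_ : CovShift.FourthMomentUpper DS α) (_ : CovShift.FourthMomentUpper DT α)
        (_ : CovShift.NoiseBound DS wStar σ) (_ : CovShift.NoiseBound DT wStar σ)
        (M : ℕ) (_ : 100 < M)
        (γ : ℝ) (_ : 0 < γ) (_ : γ < 1 / (4 * α * CovShift.trace (CovShift.secondMoment DS)))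
        -- independent source samples
        (Ω : Type*) [MeasurableSpace Ω] (P : Measure Ω) (Z : ℕ → Ω → E × ℝ)
        (_ : ∀ t < M, HasLaw (Z t) DS P) (_ : iIndepFun (fun t : Fin M => Z t) P)
        (w₀ : E),
        (∀ J : Set ι,
          ∫⁻ ω, ENNReal.ofReal (CovShift.excessRisk DT wStar
              (CovShift.sgd (CovShift.stepsize M γ) w₀ (fun t => Z t ω) M)) ∂P ≤
            C * (ENNReal.ofReal
                  (CovShift.sqNorm (CovShift.secondMoment DT)
                    (CovShift.contraction (CovShift.stepsize M γ) (CovShift.secondMoment DS) M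
                      (w₀ - wStar))) +
                (ENNReal.ofReal α *
                    CovShift.weightedSq v
                      (CovShift.headConstTail (1 / (CovShift.effSamples M * γ)) μ J)
                      (w₀ - wStar) +
                  ENNReal.ofReal (σ ^ 2)) *
                (CovShift.effDim v μ J (CovShift.secondMoment DT) (CovShift.effSamples M) γ /
                  ENNReal.ofReal (CovShift.effSamples M)))) ∧
        (∀ β : ℝ, 0 < β →
          CovShift.FourthMomentLower DS β → CovShift.FourthMomentLower DT β →
          CovShift.WellSpecified DS wStar σ → CovShift.WellSpecified DT wStar σ →
          ∀ J : Set ι, J = {j | 1 / (γ * CovShift.effSamples M) ≤ μ j} →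
            c * (ENNReal.ofReal
                  (CovShift.sqNorm (CovShift.secondMoment DT)
                    (CovShift.contraction (CovShift.stepsize M γ) (CovShift.secondMoment DS) M
                      (w₀ - wStar))) +
                (ENNReal.ofReal β *
                    CovShift.weightedSq v (CovShift.tail μ J) (w₀ - wStar) +
                  ENNReal.ofReal (σ ^ 2)) *
                (CovShift.effDim v μ J (CovShift.secondMoment DT) (CovShift.effSamples M) γ /
                  ENNReal.ofReal (CovShift.effSamples M))) ≤
              ∫⁻ ω, ENNReal.ofReal (CovShift.excessRisk DT wStar
                (CovShift.sgd (CovShift.stepsize M γ) w₀ (fun t => Z t ω) M)) ∂P) := by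
  refine ⟨(352 : ℝ).toNNReal, (Real.exp (-48) / 4).toNNReal, by simp, by simp [Real.exp_pos], ?_⟩
  intro E _ _ _ _ _ _ DS DT _ _ wStar hc ι v μ hv α σ hα hσ h4 _ hn _ M hM γ hγ hγα Ω _ P Z hZ hi w₀
  exact ⟨fun J => CovShift.excessRisk_le hc hv hα h4 hn hM hγ hγα hZ hi w₀ J,
    fun β hβ h4' _ hw _ J hJ =>
      CovShift.le_excessRisk hc hv hα h4 hn hM hγ hγα hZ hi w₀ hβ h4' hw hJ⟩
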